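/- Let $p_i,q_i\in\mathbb Z[t]$ ($i=1,2,3$) have degree at most $d$ and coefficients of absolute value at most $2^\tau$, and let $\phi=(\phi_1,\phi_2,\phi_3)=(p_1/q_1,\,p_2/q_2,\,p_3/q_3)$. Let $\widetilde{\mathcal C}\subset\mathbb C^3$ be the Zariski closure of the image of $\phi$ over $\mathbb C$, and $\mathcal C=\widetilde{\mathcal C}\cap\mathbb R^3$. Assume that - $q_i\neq 0$ and $\gcd(p_i,q_i)=1$ in $\mathbb Q[t]$ for every $i$, and no $\phi_i$ is constant; - $\phi$ is proper: all but finitely many points of $\widetilde{\mathcal C}$ are the image of exactly one complex parameter value (that is not a pole); - $\mathcal C$ has no singularity at infinity: if the limit $\mathbf p_\infty=\lim_{t\to\pm\infty}\phi(t)\in\mathbb R^3$ exists, then the derivative of $u\mapsto\phi(1/u)$ at $u=0$ is nonzero and $\mathbf p_\infty\ne\phi(t)$ for every real $t$ that is not a pole. For an integer $a$ let $\pi_a(x,y,z)=(x,\,y+az)$. One can compute from $d$ and the coefficients of the $p_i,q_i$ an integer $a$ such that - (C1) no asymptote of $\mathcal C$ is parallel to the projection direction $\ker\pi_a=\mathbb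 R\,(0,-a,1)$, where an asymptote is a line whose distance to $\phi(t)$ tends to $0$ while $\|\phi(t)\|\to\infty$, as $t\to+\infty$, as $t\to-\infty$, or as $t$ tends from one side to some $t_0\in\mathbb R$; - (C2) $\pi_a$ is a birational map from $\widetilde{\mathcal C}$ onto the Zariski closure of $\pi_a(\widetilde{\mathcal C})$. More precisely, there is a deterministic algorithm for this of worst-case bit complexity $\widetilde{\mathcal O}_B(d^5+d^4\tau)$, and there is a Las Vegas algorithm (one that tosses fair coins and never returns a wrong output) of expected bit complexity $\widetilde{\mathcal O}_B(d^3+d^2\tau)$. Here bit complexity is the logarithmic cost of a random access machine with operations $+,-,\cdot,/$ on integers, and $f=\widetilde{\mathcal O}_B(g)$ means that $f\le C\,g\,(\log g+1)^k$ for constants $C,k$ that do not depend on the input. -/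

import Mathlib

open Filter Topology MeasureTheory Polynomial
open scoped ENNReal

noncomputable section

/-! ### Rational parametrizations and the curves they define -/

/-- The data of a rational parametrization `t ↦ (p₁(t)/q₁(t), …, pₙ(t)/qₙ(t))`
with `pᵢ, qᵢ ∈ ℤ[t]`. -/
structure RatParam (n : ℕ) where
  /-- the numerators `pᵢ` -/
  num : Fin n → ℤ[X]
  /-- the denominators `qᵢ` -/
  den : Fin n → ℤ[X]

namespace RatParam

variable {n : ℕ}

/-- The value `φ(t)`; meaningful only when `t` is not a pole. -/
def eval {K : Type*} [Field K] (φ : RatParam n) (t : K) : Fin n → K :=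
  fun i => aeval t (φ.num i) / aeval t (φ.den i)

/-- `t` is a pole of `φ`. -/
def IsPole {K : Type*} [Field K] (φ : RatParam n) (t : K) : Prop :=
  ∃ i, aeval t (φ.den i) = 0

/-- All `pᵢ`, `qᵢ` have degree at most `d` and bitsize at most `τ`
(coefficients at most `2 ^ τ` in absolute value). -/
def HasSize (φ : RatParam n) (d τ : ℕ) : Prop :=
  ∀ i, ((φ.num i).natDegree ≤ d ∧ ∀ j, |(φ.num i).coeff j| ≤ 2 ^ τ) ∧
    ((φ.den i).natDegree ≤ d ∧ ∀ j, |(φ.den i).coeff j| ≤ 2 ^ τ)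

/-- The denominators are nonzero and `φ` is in reduced form: `gcd(pᵢ, qᵢ) = 1` over `ℚ`. -/
def IsReduced (φ : RatParam n) : Prop :=
  ∀ i, φ.den i ≠ 0 ∧
    IsCoprime ((φ.num i).map (Int.castRingHom ℚ)) ((φ.den i).map (Int.castRingHom ℚ))

/-- No coordinate `pᵢ/qᵢ` is constant. -/
def NoConstantCoord (φ : RatParam n) : Prop :=
  ∀ i, ¬ ∃ c : ℚ, (φ.num i).map (Int.castRingHom ℚ) =
    Polynomial.C c * (φ.den i).map (Int.castRingHom ℚ)

/-- The image of `φ` in `ℂⁿ`. -/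
def image (φ : RatParam n) : Set (Fin n → ℂ) :=
  {x | ∃ t : ℂ, ¬ φ.IsPole t ∧ φ.eval t = x}

end RatParam

/-- Zariski closure of a subset of `ℂⁿ`. -/
def zariskiClosure {n : ℕ} (S : Set (Fin n → ℂ)) : Set (Fin n → ℂ) :=
  MvPolynomial.zeroLocus ℂ (MvPolynomial.vanishingIdeal ℂ S)

namespace RatParam

variable {n : ℕ}

/-- The complex algebraic curve parametrized by `φ`. -/
def complexCurve (φ : RatParam n) : Set (Fin n → ℂ) :=
  zariskiClosure φ.image

/-- `φ` is proper: almost every (all but finitely many) point of the complex curve is the image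
of exactly one complex parameter value. -/
def IsProper (φ : RatParam n) : Prop :=
  {x | x ∈ φ.complexCurve ∧ ¬ ∃! t : ℂ, ¬ φ.IsPole t ∧ φ.eval t = x}.Finite

/-- `x` is the point at infinity `lim_{t → ±∞} φ(t)` of the real curve. -/
def IsPointAtInfinity (φ : RatParam n) (x : Fin n → ℝ) : Prop :=
  Tendsto (fun t : ℝ => φ.eval t) (atBot ⊔ atTop) (𝓝 x)

/-- The point at infinity `x` is singular: it is a cusp, i.e. the tangent vector of
`u ↦ φ(1/u)` at `u = 0` (which is `lim_{t → ±∞} t (φ(t) - x)`) vanishes, or it is a multiple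
point, i.e. it is also attained at a finite real parameter. -/
def IsSingularAtInfinity (φ : RatParam n) (x : Fin n → ℝ) : Prop :=
  Tendsto (fun t : ℝ => t • (φ.eval t - x)) (atBot ⊔ atTop) (𝓝 0) ∨
    ∃ t : ℝ, ¬ φ.IsPole t ∧ φ.eval t = x

/-- The point at infinity, if it exists, is not a singular point. -/
def NoSingularityAtInfinity (φ : RatParam n) : Prop :=
  ∀ x, φ.IsPointAtInfinity x → ¬ φ.IsSingularAtInfinity x

/-- The affine line through `p` with direction `v`. -/
def line (p v : Fin n → ℝ) : Set (Fin n → ℝ) :=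
  {x | ∃ s : ℝ, x = p + s • v}

/-- The ends of the real parameter line along which a branch of the curve can run:
`t → ±∞` and `t → t₀` from one side, for `t₀ ∈ ℝ`. -/
def IsParameterEnd (l : Filter ℝ) : Prop :=
  l = atTop ∨ l = atBot ∨ ∃ t₀ : ℝ, l = 𝓝[<] t₀ ∨ l = 𝓝[>] t₀

/-- The line through `p` with direction `v ≠ 0` is an asymptote of the real curve: some real
branch tends to infinity while its distance to the line tends to zero.
(The choice of norm on `ℝⁿ` does not matter here.) -/
def IsAsymptote (φ : RatParam n) (p v : Fin n → ℝ) : Prop :=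
  v ≠ 0 ∧ ∃ l : Filter ℝ, IsParameterEnd l ∧
    Tendsto (fun t : ℝ => ‖φ.eval t‖) l atTop ∧
    Tendsto (fun t : ℝ => Metric.infDist (φ.eval t) (line p v)) l (𝓝 0)

end RatParam

/-! ### Projections -/

/-- The projection `(x, y, z) ↦ (x, y + a z)`. -/
def shearProj {K : Type*} [Ring K] (a : ℤ) (x : Fin 3 → K) : Fin 2 → K :=
  ![x 0, x 1 + (a : K) * x 2]

/-- For an irreducible closed `V ⊆ ℂᵐ` and a polynomial map `f`, the map
`f : V → W`, with `W` the Zariski closure of `f(V)`, is birational: there is a rational map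
`ρ = (u₁/w₁, …, u_m/w_m)`, defined on a nonempty open subset of `W`, that is inverse to `f`
wherever it is defined. -/
def IsBirationalOntoImage {m k : ℕ} (V : Set (Fin m → ℂ))
    (f : (Fin m → ℂ) → (Fin k → ℂ)) : Prop :=
  ∃ u w : Fin m → MvPolynomial (Fin k) ℂ,
    (∃ y ∈ zariskiClosure (f '' V), ∀ i, MvPolynomial.eval y (w i) ≠ 0) ∧
    (∀ x ∈ V, (∀ i, MvPolynomial.eval (f x) (w i) ≠ 0) →
      (fun i => MvPolynomial.eval (f x) (u i) / MvPolynomial.eval (f x) (w i)) = x) ∧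
    (∀ y ∈ zariskiClosure (f '' V), (∀ i, MvPolynomial.eval y (w i) ≠ 0) →
      (fun i => MvPolynomial.eval y (u i) / MvPolynomial.eval y (w i)) ∈ V ∧
      f (fun i => MvPolynomial.eval y (u i) / MvPolynomial.eval y (w i)) = y)

namespace RatParam

/-- The input curves: reduced, no constant coordinate, proper, no singularity at infinity. -/
def IsAdmissible (φ : RatParam 3) : Prop :=
  φ.IsReduced ∧ φ.NoConstantCoord ∧ φ.IsProper ∧ φ.NoSingularityAtInfinity

/-- The projection `(x, y, z) ↦ (x, y + a z)` is admissible for the curve: no asymptote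
of the real curve is parallel to the projection direction (the kernel of the projection), and
the projection is birational from the curve onto its image. -/
def IsGoodProjection (φ : RatParam 3) (a : ℤ) : Prop :=
  (∀ p v : Fin 3 → ℝ, φ.IsAsymptote p v → shearProj a v ≠ 0) ∧
    IsBirationalOntoImage φ.complexCurve (shearProj a)

end RatParam

/-! ### Bit complexity: random access machines with logarithmic cost

The machine has registers `r₀, r₁, …` holding integers, direct and indirect addressing, and the
operations `+`, `-`, `*`, `/`; every operand is charged by the bit lengths of the integers and
addresses involved. Programs are written in structured form. Tossing a fair coin is an extra
instruction. -/

namespace RAM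

/-- The bit length of an integer (with `0` of length `1`). -/
def len (z : ℤ) : ℕ := Nat.log 2 z.natAbs + 1

/-- Operands: a constant, the register `rᵢ`, or the register whose address is held in `rᵢ`. -/
inductive Operand where
  | const (z : ℤ)
  | reg (i : ℕ)
  | ind (i : ℕ)

/-- Destinations: the register `rᵢ`, or the register whose address is held in `rᵢ`. -/
inductive Dest where
  | reg (i : ℕ)
  | ind (i : ℕ)

/-- The arithmetic operations; `div` is integer division. -/
inductive Op where
  | add
  | sub
  | mul
  | div

/-- The value of an operand. -/
def Operand.val (m : ℕ → ℤ) : Operand → ℤ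
  | const z => z
  | reg i => m i
  | ind i => m (m i).toNat

/-- The logarithmic cost of an operand. -/
def Operand.cost (m : ℕ → ℤ) : Operand → ℕ
  | const z => len z
  | reg i => len i + len (m i)
  | ind i => len i + len (m i) + len (m (m i).toNat)

/-- The register a destination refers to. -/
def Dest.addr (m : ℕ → ℤ) : Dest → ℕ
  | reg i => i
  | ind i => (m i).toNat

/-- The logarithmic cost of addressing a destination. -/
def Dest.cost (m : ℕ → ℤ) : Dest → ℕ
  | reg i => len i
  | ind i => len i + len (m i)

/-- The result of an arithmetic operation. -/
def Op.apply : Op → ℤ → ℤ → ℤ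
  | add, x, y => x + y
  | sub, x, y => x - y
  | mul, x, y => x * y
  | div, x, y => x / y

/-- Programs. -/
inductive Prog where
  | skip
  | arith (dst : Dest) (op : Op) (x y : Operand)
  | coin (dst : Dest)
  | seq (P Q : Prog)
  | ite (x : Operand) (P Q : Prog)
  | loop (x : Operand) (P : Prog)

/-- The program never tosses a coin. -/
def Prog.IsDeterministic : Prog → Prop
  | skip => True
  | arith _ _ _ _ => True
  | coin _ => False
  | seq P Q => P.IsDeterministic ∧ Q.IsDeterministic
  | ite _ P Q => P.IsDeterministic ∧ Q.IsDeterministic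
  | loop _ P => P.IsDeterministic

/-- A state: the registers and the stream of coin tosses still to come. -/
structure State where
  mem : ℕ → ℤ
  coins : ℕ → Bool

/-- `Exec P s s' c`: started in state `s`, the program `P` halts in state `s'` at total cost `c`.
`ite x P Q` runs `P` if the operand `x` is positive and `Q` otherwise; `loop x P` repeats `P` as
long as `x` is positive. -/
inductive Exec : Prog → State → State → ℕ → Prop where
  | skip (s : State) : Exec Prog.skip s s 1
  | arith (s : State) (dst : Dest) (op : Op) (x y : Operand) :
      Exec (Prog.arith dst op x y) s
        ⟨Function.update s.mem (dst.addr s.mem) (op.apply (x.val s.mem) (y.val s.mem)), s.coins⟩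
        (x.cost s.mem + y.cost s.mem + dst.cost s.mem +
          len (op.apply (x.val s.mem) (y.val s.mem)))
  | coin (s : State) (dst : Dest) :
      Exec (Prog.coin dst) s
        ⟨Function.update s.mem (dst.addr s.mem) (if s.coins 0 then 1 else 0),
          fun k => s.coins (k + 1)⟩
        (dst.cost s.mem + 1)
  | seq {P Q : Prog} {s s' s'' : State} {c c' : ℕ} :
      Exec P s s' c → Exec Q s' s'' c' → Exec (Prog.seq P Q) s s'' (c + c')
  | ite_pos {x : Operand} {P Q : Prog} {s s' : State} {c : ℕ} :
      0 < x.val s.mem → Exec P s s' c → Exec (Prog.ite x P Q) s s' (x.cost s.mem + c)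
  | ite_neg {x : Operand} {P Q : Prog} {s s' : State} {c : ℕ} :
      ¬ 0 < x.val s.mem → Exec Q s s' c → Exec (Prog.ite x P Q) s s' (x.cost s.mem + c)
  | loop_stop {x : Operand} {P : Prog} {s : State} :
      ¬ 0 < x.val s.mem → Exec (Prog.loop x P) s s (x.cost s.mem)
  | loop_step {x : Operand} {P : Prog} {s s' s'' : State} {c c' : ℕ} :
      0 < x.val s.mem → Exec P s s' c → Exec (Prog.loop x P) s' s'' c' →
        Exec (Prog.loop x P) s s'' (x.cost s.mem + c + c')

/-- The cost of the run of `P` from `s`; it is `∞` if `P` does not halt. -/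
def runCost (P : Prog) (s : State) : ℝ≥0∞ :=
  ⨅ (s' : State) (c : ℕ) (_ : Exec P s s' c), (c : ℝ≥0∞)

/-- The law of an infinite sequence of independent fair coin tosses. -/
def coinLaw : Measure (ℕ → Bool) :=
  Measure.infinitePi fun _ => (PMF.uniformOfFintype Bool).toMeasure

/-- The expected cost of `P` on the initial registers `m`. -/
def expectedCost (P : Prog) (m : ℕ → ℤ) : ℝ≥0∞ :=
  ∫⁻ ω, runCost P ⟨m, ω⟩ ∂coinLaw

/-- Dense encoding of a list of polynomials of degree at most `d`: register `0` holds `d`, and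
the following registers hold, for one polynomial after the other, the coefficients of
degrees `0, …, d`; all other registers hold `0`. -/
def encode (d : ℕ) (L : List ℤ[X]) : ℕ → ℤ
  | 0 => d
  | k + 1 => (L.getD (k / (d + 1)) 0).coeff (k % (d + 1))

/-- The input registers for a parametrization with polynomials of degree at most `d`. -/
def input (d : ℕ) (φ : RatParam 3) : ℕ → ℤ :=
  encode d [φ.num 0, φ.den 0, φ.num 1, φ.den 1, φ.num 2, φ.den 2]

end RAM

/-- The quantity `C · g · (log g + 1) ^ k`: a function is `Õ(g)` if it is bounded by this for some
constants `C` and `k`. -/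
def softBound (C k g : ℕ) : ℕ := C * g * (Nat.log 2 g + 1) ^ k

end

/-! Every bad integer `a` is bounded by an explicit function of the input, so one very large `a` is
good. No search or randomness is needed: a single coin-free program serves for both claims. Why bad
integers are bounded. If (C2) fails, then for a generic parameter `t₀` some `s ≠ t₀` has the same
first coordinate and the same value of `y + a z`. If (C1) fails, then `y / z → -a` along a branch
where `z` is unbounded. At `t → ±∞` this makes `a` divide a leading coefficient
(`dvd_leadingCoeff_of_tendsto_atTop`). At a finite pole `t₀` the denominators of `y` and `z` vanish
to the same order `m`, and `p₂ q₃⁽ᵐ⁾ + a p₃ q₂⁽ᵐ⁾ = 0` at `t₀`, the derivatives being Hasse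
derivatives. The first and the last case have one shape: polynomials `f` and `g + a h` share a root
where `g` and `h` do not both vanish. `exists_dvd_of_pencil_root` treats it over `ℤ[t]` and over
`ℤ`: `a` is a root of a nonzero polynomial extracted from a resultant, so it divides the trailing
coefficient of that polynomial, whose size the `ℓ¹` norm controls. With `T` above `2 ^ (6 d + 3)`
and the `ℓ¹` norms of the input, all bounds stay below `T ^ (19 d)` (`isGoodProjection_pow`). That
injectivity at a generic point gives birationality is Galois theory (`isBirational_of_separating`):
`t₀` has no other conjugate over the field generated by its projection, so it lies in that field.
Cost: `T` has `O(d + τ)` bits and `T ^ (19 d)` has `O(d (d + τ))`. Computing the power by `19 d`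
multiplications costs `O(d³ + d² τ)`, which is below both required bounds. -/

noncomputable section

/-! ### The `ℓ¹` seminorm on polynomials -/

section LOne

variable {A : Type*} [CommRing A]

/-- The sum of the seminorms of the coefficients of a polynomial. -/
def coeffSum (ν : RingSeminorm A) (p : A[X]) : ℝ := ∑ i ∈ p.support, ν (p.coeff i)

lemma coeffSum_eq_sum (ν : RingSeminorm A) (p : A[X]) {s : Finset ℕ} (h : p.support ⊆ s) :
    coeffSum ν p = ∑ i ∈ s, ν (p.coeff i) :=
  Finset.sum_subset h fun i _ hi => by simp [notMem_support_iff.mp hi]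

lemma coeffSum_add_le (ν : RingSeminorm A) (p q : A[X]) :
    coeffSum ν (p + q) ≤ coeffSum ν p + coeffSum ν q := by
  classical
  rw [coeffSum_eq_sum ν (p + q) support_add,
    coeffSum_eq_sum ν p (Finset.subset_union_left (s₂ := q.support)),
    coeffSum_eq_sum ν q (Finset.subset_union_right (s₁ := p.support)), ← Finset.sum_add_distrib]
  exact Finset.sum_le_sum fun i _ => by simpa using map_add_le_add ν _ _

lemma coeffSum_zero (ν : RingSeminorm A) : coeffSum ν 0 = 0 := by simp [coeffSum]

lemma coeffSum_sum_le (ν : RingSeminorm A) {ι : Type*} (s : Finset ι) (f : ι → A[X]) :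
    coeffSum ν (∑ i ∈ s, f i) ≤ ∑ i ∈ s, coeffSum ν (f i) :=
  Finset.le_sum_of_subadditive _ (coeffSum_zero ν).le (coeffSum_add_le ν) _ _

lemma coeffSum_monomial (ν : RingSeminorm A) (n : ℕ) (c : A) :
    coeffSum ν (monomial n c) = ν c := by
  rw [coeffSum_eq_sum ν _ (support_monomial_subset n c)]
  simp

/-- The `ℓ¹` seminorm on polynomials over a seminormed ring. -/
def lOne (ν : RingSeminorm A) : RingSeminorm A[X] where
  toFun := coeffSum ν
  map_zero' := coeffSum_zero ν
  add_le' := coeffSum_add_le ν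
  neg' p := by simp [coeffSum]
  mul_le' p q := by
    rw [mul_eq_sum_sum]
    refine (coeffSum_sum_le ν _ _).trans ?_
    rw [coeffSum, coeffSum, Finset.sum_mul_sum]
    refine Finset.sum_le_sum fun i _ => ?_
    rw [Polynomial.sum_def]
    refine (coeffSum_sum_le ν _ _).trans (Finset.sum_le_sum fun j _ => ?_)
    rw [coeffSum_monomial]
    exact map_mul_le_mul ν _ _

lemma lOne_apply (ν : RingSeminorm A) (p : A[X]) :
    lOne ν p = ∑ i ∈ p.support, ν (p.coeff i) := rfl

lemma lOne_C (ν : RingSeminorm A) (c : A) : lOne ν (C c) = ν c := coeffSum_monomial ν 0 c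

lemma lOne_X (ν : RingSeminorm A) : lOne ν X = ν 1 := coeffSum_monomial ν 1 1

lemma coeff_le_lOne (ν : RingSeminorm A) (p : A[X]) (i : ℕ) : ν (p.coeff i) ≤ lOne ν p := by
  by_cases h : i ∈ p.support
  · exact Finset.single_le_sum (f := fun i => ν (p.coeff i)) (fun _ _ => apply_nonneg ν _) h
  · rw [notMem_support_iff.mp h, map_zero]
    exact apply_nonneg _ _

lemma lOne_map_le {B : Type*} [CommRing B] (ν : RingSeminorm A) (μ : RingSeminorm B) (σ : A →+* B)
    (h : ∀ x, μ (σ x) ≤ ν x) (p : A[X]) : lOne μ (p.map σ) ≤ lOne ν p := by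
  rw [lOne_apply, lOne_apply]
  refine (Finset.sum_le_sum_of_subset_of_nonneg (support_map_subset σ p)
    fun _ _ _ => apply_nonneg μ _).trans (Finset.sum_le_sum fun i _ => ?_)
  rw [coeff_map]
  exact h _

end LOne

lemma RingSeminorm.prod_le {A ι : Type*} [CommRing A] (ν : RingSeminorm A) (h1 : ν 1 ≤ 1)
    (s : Finset ι) (f : ι → A) : ν (∏ i ∈ s, f i) ≤ ∏ i ∈ s, ν (f i) := by
  classical
  induction s using Finset.induction_on with
  | empty => simpa using h1
  | insert i s hi ih =>
    rw [Finset.prod_insert hi, Finset.prod_insert hi]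
    exact (map_mul_le_mul ν _ _).trans (mul_le_mul_of_nonneg_left ih (apply_nonneg ν _))

/-- A crude bound for the seminorm of a determinant. -/
lemma RingSeminorm.det_le {A n : Type*} [CommRing A] [Fintype n] [DecidableEq n]
    (ν : RingSeminorm A) (h1 : ν 1 ≤ 1) (M : Matrix n n A) {B : ℝ} (hM : ∀ i j, ν (M i j) ≤ B) :
    ν M.det ≤ (Fintype.card n).factorial * B ^ Fintype.card n := by
  rw [Matrix.det_apply]
  refine (Finset.le_sum_of_subadditive ν (map_zero ν).le (map_add_le_add ν) _ _).trans ?_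
  have key : ∀ σ ∈ (Finset.univ : Finset (Equiv.Perm n)),
      ν (Equiv.Perm.sign σ • ∏ i, M (σ i) i) ≤ B ^ Fintype.card n := by
    intro σ _
    have : ν (Equiv.Perm.sign σ • ∏ i, M (σ i) i) = ν (∏ i, M (σ i) i) := by
      rcases Int.units_eq_one_or (Equiv.Perm.sign σ) with h | h <;> simp [h, map_neg_eq_map]
    rw [this]
    refine (ν.prod_le h1 _ _).trans ?_
    refine (Finset.prod_le_prod (fun _ _ => apply_nonneg ν _) fun i _ => hM (σ i) i).trans ?_
    simp
  refine (Finset.sum_le_sum key).trans ?_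
  simp [Fintype.card_perm]

/-! ### Trailing coefficients -/

lemma Polynomial.trailingCoeff_map_of_injective {A B : Type*} [CommRing A] [CommRing B]
    {σ : A →+* B} (hσ : Function.Injective σ) (p : A[X]) :
    (p.map σ).trailingCoeff = σ p.trailingCoeff := by
  by_cases hp : p = 0
  · simp [hp]
  have hp' : p.map σ ≠ 0 := (Polynomial.map_ne_zero_iff hσ).mpr hp
  have : (p.map σ).natTrailingDegree = p.natTrailingDegree := by
    simp only [natTrailingDegree_eq_support_min' hp, natTrailingDegree_eq_support_min' hp',
      support_map_of_injective p hσ]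
  rw [trailingCoeff, trailingCoeff, coeff_map, this]

/-- After the power of `X` is divided out, the trailing coefficient is the constant term `q(0)`, and
`a` divides `q(0) - q(a)`. -/
lemma Polynomial.dvd_trailingCoeff_of_eval_eq_zero {A : Type*} [CommRing A] [IsDomain A]
    {p : A[X]} {a : A} (ha : a ≠ 0) (h : p.eval a = 0) : a ∣ p.trailingCoeff := by
  obtain ⟨q, hq⟩ : X ^ p.natTrailingDegree ∣ p :=
    X_pow_dvd_iff.mpr fun d hd => coeff_eq_zero_of_lt_natTrailingDegree hd
  have hc : p.trailingCoeff = q.coeff 0 := by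
    conv_lhs => rw [trailingCoeff]
    nth_rewrite 1 [hq]
    simpa using coeff_X_pow_mul q p.natTrailingDegree 0
  rw [hq, eval_mul, eval_pow, eval_X, mul_eq_zero, or_iff_right (pow_ne_zero _ ha)] at h
  rw [hc, coeff_zero_eq_eval_zero]
  have := sub_dvd_eval_sub a 0 q
  rw [h] at this
  simpa using this

lemma Polynomial.trailingCoeff_multiset_prod {A : Type*} [CommRing A] [IsDomain A]
    (s : Multiset A[X]) : s.prod.trailingCoeff = (s.map trailingCoeff).prod := by
  induction s using Multiset.induction_on with
  | empty => simp [trailingCoeff]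
  | cons a s ih => simp [trailingCoeff_mul, ih]

lemma Polynomial.trailingCoeff_X_add_C {A : Type*} [CommRing A] [IsDomain A] [DecidableEq A] (c : A) :
    (X + C c).trailingCoeff = if c = 0 then 1 else c := by
  split_ifs with h
  · simp [h, trailingCoeff]
  · rw [trailingCoeff_eq_coeff_zero] <;> simp [h]

/-! ### Height bound for the parameter of a pencil sharing a root with a polynomial -/

/-- The pencil `g + x h + y`, with coefficients in `A[x][y]`. -/
def perturbedPencil {A : Type*} [CommRing A] (g h : A[X]) : A[X][X][X] :=
  g.map (C.comp C) + C (C X) * h.map (C.comp C) + C X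

/-- If `g + a h` vanishes at a root of `f` at which `g` and `h` do not both vanish, then `a`
divides a nonzero element of controlled size. -/
theorem exists_dvd_of_pencil_root {A K : Type*} [CommRing A] [IsDomain A] [Field K] [IsAlgClosed K]
    (ν : RingSeminorm A) (h1 : ν 1 ≤ 1) {σ : A →+* K} (hσ : Function.Injective σ)
    {f g h : A[X]} (hf0 : f ≠ 0) {n : ℕ} (hg : g.natDegree ≤ n) (hh : h.natDegree ≤ n)
    {B : ℝ} (hfB : lOne ν f ≤ B) (hghB : lOne ν g + lOne ν h + 1 ≤ B)
    {s : K} (hs : f.eval₂ σ s = 0) (hne : ¬ (g.eval₂ σ s = 0 ∧ h.eval₂ σ s = 0))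
    {a : A} (ha : a ≠ 0) (hroot : g.eval₂ σ s + σ a * h.eval₂ σ s = 0) :
    ∃ r : A, r ≠ 0 ∧ a ∣ r ∧
      ν r ≤ (f.natDegree + n).factorial * B ^ (f.natDegree + n) := by
  classical
  -- The extra variable `y` matters: `f`, `g`, `h` may have common roots (such as `s = t` for
  -- differences `φ(s) - φ(t)`), and then the resultant of `f` and `g + x h` is identically zero.
  set F : A[X][X] := resultant (f.map (C.comp C)) (perturbedPencil g h) f.natDegree n with hF
  set σ' : A[X][X] →+* K[X][X] := mapRingHom (mapRingHom σ) with hσ'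
  have hσ1 : Function.Injective (mapRingHom σ) := map_injective σ hσ
  have hσ'inj : Function.Injective σ' := map_injective _ hσ1
  have hCC : Function.Injective ((C : K[X] →+* K[X][X]).comp (C : K →+* K[X])) :=
    C_injective.comp C_injective
  have hcomp : σ'.comp (C.comp C) = ((C : K[X] →+* K[X][X]).comp (C : K →+* K[X])).comp σ := by
    ext x; simp [σ']
  have hsplit : ((f.map σ).map ((C : K[X] →+* K[X][X]).comp (C : K →+* K[X]))).Splits :=
    (IsAlgClosed.splits _).map _
  have hdeg : ((f.map σ).map ((C : K[X] →+* K[X][X]).comp (C : K →+* K[X]))).natDegree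
      = f.natDegree := by
    rw [natDegree_map_eq_of_injective hCC, natDegree_map_eq_of_injective hσ]
  have hpdeg : ((perturbedPencil g h).map σ').natDegree ≤ n := by
    refine natDegree_map_le.trans (natDegree_add_le_of_degree_le (natDegree_add_le_of_degree_le
      (natDegree_map_le.trans hg) ?_) (by simp))
    exact (natDegree_C_mul_le _ _).trans (natDegree_map_le.trans hh)
  have heval : ∀ x : K, ((perturbedPencil g h).map σ').eval (C (C x))
      = X + C (C (g.eval₂ σ x) + X * C (h.eval₂ σ x)) := by
    intro x
    have e : ∀ p : A[X], eval (C (C x)) ((p.map (C.comp C)).map σ') = C (C (p.eval₂ σ x)) := by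
      intro p
      rw [Polynomial.map_map, hcomp, ← Polynomial.map_map, eval_map,
        show (C (C x) : K[X][X]) = ((C : K[X] →+* K[X][X]).comp (C : K →+* K[X])) x from rfl,
        eval₂_at_apply, eval_map]
      rfl
    simp only [perturbedPencil, Polynomial.map_add, Polynomial.map_mul, eval_add, eval_mul, e,
      map_C, eval_C]
    simp [σ']
    ring
  have hFmap : F.map (mapRingHom σ) = σ' F := rfl
  -- Over `K` the resultant splits into one factor `y + g(ξ) + x h(ξ)` for each root `ξ` of `f`.
  -- Each factor is monic in `y`, so `F ≠ 0`.
  have hFprod : F.map (mapRingHom σ) =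
      C (C (f.map σ).leadingCoeff) ^ n *
        ((f.map σ).roots.map fun x => X + C (C (g.eval₂ σ x) + X * C (h.eval₂ σ x))).prod := by
    rw [hFmap, hF, ← resultant_map_map, Polynomial.map_map, hcomp, ← Polynomial.map_map]
    conv_lhs => rw [← hdeg]
    rw [resultant_eq_prod_eval _ _ n hpdeg hsplit, (IsAlgClosed.splits _).roots_map,
      Multiset.map_map, leadingCoeff_map_of_injective hCC]
    simp only [Function.comp_def, RingHom.comp_apply, heval]
  have hfσ : f.map σ ≠ 0 := (Polynomial.map_ne_zero_iff hσ).mpr hf0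
  have hF0 : F ≠ 0 := by
    intro h0
    rw [h0, Polynomial.map_zero] at hFprod
    have := hFprod.symm
    rw [mul_eq_zero, Multiset.prod_eq_zero_iff] at this
    rcases this with h0 | h0
    · exact hfσ (by simpa using eq_zero_of_pow_eq_zero h0)
    · obtain ⟨x, -, hx⟩ := Multiset.mem_map.mp h0
      exact X_add_C_ne_zero _ hx
  have hsr : s ∈ (f.map σ).roots := by
    rw [mem_roots hfσ, IsRoot, eval_map, hs]
  -- The lowest coefficient in `y` is the product of the nonzero forms `g(ξ) + x h(ξ)`; common roots
  -- of `g` and `h` only contribute `1`. The form at `s` is nonzero and vanishes at `x = a`.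
  have hT : eval (σ a) (F.trailingCoeff.map σ) = 0 := by
    have : F.trailingCoeff.map σ = (F.map (mapRingHom σ)).trailingCoeff := by
      rw [trailingCoeff_map_of_injective hσ1]; rfl
    rw [this, hFprod, trailingCoeff_mul, trailingCoeff_multiset_prod, Multiset.map_map,
      eval_mul, eval_multiset_prod, Multiset.map_map]
    refine mul_eq_zero_of_right _ (Multiset.prod_eq_zero (Multiset.mem_map.mpr ⟨s, hsr, ?_⟩))
    simp only [Function.comp_apply]
    rw [trailingCoeff_X_add_C, if_neg]
    · simp only [eval_add, eval_mul, eval_X, eval_C]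
      exact hroot
    · intro h0
      refine hne ⟨?_, ?_⟩
      · simpa using congrArg (coeff · 0) h0
      · simpa using congrArg (coeff · 1) h0
  have hT' : F.trailingCoeff.eval a = 0 := by
    apply hσ
    rw [map_zero, ← hT, eval_map, eval₂_at_apply]
  refine ⟨F.trailingCoeff.trailingCoeff, ?_, dvd_trailingCoeff_of_eval_eq_zero ha hT', ?_⟩
  · rwa [trailingCoeff_nonzero_iff_nonzero, trailingCoeff_nonzero_iff_nonzero]
  · refine ((coeff_le_lOne ν _ _).trans (coeff_le_lOne (lOne ν) _ _)).trans ?_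
    -- Taking a coefficient does not increase the `ℓ¹` norm, so it suffices to bound the Sylvester
    -- determinant, whose entries are zero or coefficients of `f` and of the pencil.
    set μ := lOne (lOne ν)
    have hμ1 : μ 1 ≤ 1 := by
      rw [← C_1, lOne_C, ← C_1, lOne_C]; exact h1
    have hμC : ∀ x : A, μ ((C.comp C : A →+* A[X][X]) x) ≤ ν x := fun x => by
      rw [RingHom.comp_apply, lOne_C, lOne_C]
    have hf' : lOne μ (f.map (C.comp C)) ≤ B := (lOne_map_le ν μ _ hμC f).trans hfB
    have hp' : lOne μ (perturbedPencil g h) ≤ B := by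
      refine le_trans ?_ hghB
      refine (map_add_le_add _ _ _).trans (add_le_add ((map_add_le_add _ _ _).trans
        (add_le_add (lOne_map_le ν μ _ hμC g) ?_)) ?_)
      · refine (map_mul_le_mul _ _ _).trans ?_
        refine (mul_le_mul_of_nonneg_right (b := lOne μ (C (C X))) (c := 1) ?_
          (apply_nonneg _ _)).trans ?_
        · rw [lOne_C, lOne_C, lOne_X]; exact h1
        · rw [one_mul]; exact lOne_map_le ν μ _ hμC h
      · rw [lOne_C, lOne_X, ← C_1, lOne_C]; exact h1
    have hB0 : 0 ≤ B := (apply_nonneg _ _).trans hf'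
    have := μ.det_le hμ1 (sylvester (f.map (C.comp C)) (perturbedPencil g h) f.natDegree n)
      (B := B) fun i j => by
        rw [sylvester, Matrix.of_apply]
        refine j.addCases (fun j => ?_) fun j => ?_
        · rw [Fin.addCases_left]
          split_ifs
          · exact (coeff_le_lOne μ _ _).trans hp'
          · simpa using hB0
        · rw [Fin.addCases_right]
          split_ifs
          · exact (coeff_le_lOne μ _ _).trans hf'
          · simpa using hB0
    simpa [hF, resultant] using this

/-! ### Zariski closures and rational inverses -/

/-- The form in which closures are used below: a polynomial identity valid on `S` extends to its
closure. -/
lemma mem_zariskiClosure_iff {n : ℕ} {S : Set (Fin n → ℂ)} {x : Fin n → ℂ} :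
    x ∈ zariskiClosure S ↔ ∀ p : MvPolynomial (Fin n) ℂ,
      (∀ y ∈ S, MvPolynomial.eval y p = 0) → MvPolynomial.eval x p = 0 := by
  simp only [zariskiClosure, MvPolynomial.mem_zeroLocus_iff, MvPolynomial.mem_vanishingIdeal_iff,
    MvPolynomial.aeval_eq_eval]

lemma subset_zariskiClosure {n : ℕ} (S : Set (Fin n → ℂ)) : S ⊆ zariskiClosure S :=
  fun _ hx => mem_zariskiClosure_iff.mpr fun _ hp => hp _ hx

/-- Clearing denominators in `g(u₁/w₁, …, uₙ/wₙ)`. -/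
lemma exists_clear_denominators {k R K : Type*} {n : ℕ} [Field k] [CommRing R] [Algebra k R]
    [Field K] [Algebra k K] (u w : Fin n → R) (g : MvPolynomial (Fin n) k) :
    ∃ (N : ℕ) (G : R), ∀ ε : R →ₐ[k] K, (∀ i, ε (w i) ≠ 0) →
      ε G = (∏ i, ε (w i)) ^ N * MvPolynomial.aeval (fun i => ε (u i) / ε (w i)) g := by
  induction g using MvPolynomial.induction_on with
  | C c => exact ⟨0, algebraMap k R c, fun ε _ => by simp⟩
  | add p q hp hq =>
    obtain ⟨N, G, hG⟩ := hp
    obtain ⟨M, H, hH⟩ := hq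
    refine ⟨N + M, (∏ i, w i) ^ M * G + (∏ i, w i) ^ N * H, fun ε hε => ?_⟩
    rw [map_add, map_mul, map_mul, map_pow, map_pow, map_prod, hG ε hε, hH ε hε, map_add]
    ring
  | mul_X p i hp =>
    obtain ⟨N, G, hG⟩ := hp
    refine ⟨N + 1, G * (u i * ∏ j ∈ Finset.univ.erase i, w j), fun ε hε => ?_⟩
    have hW : ∏ j, ε (w j) = ε (w i) * ∏ j ∈ Finset.univ.erase i, ε (w j) :=
      (Finset.mul_prod_erase _ _ (Finset.mem_univ i)).symm
    rw [map_mul, map_mul, map_prod, hG ε hε, map_mul, MvPolynomial.aeval_X, pow_succ, hW]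
    field_simp [hε i]

/-- A polynomial map that has a rational inverse on `S` is birational from the Zariski closure
of `S` onto its image. -/
theorem isBirationalOntoImage_of_rational_inverse {m k : ℕ} {S : Set (Fin m → ℂ)}
    (F : Fin k → MvPolynomial (Fin m) ℂ) {f : (Fin m → ℂ) → (Fin k → ℂ)}
    (hf : ∀ x j, f x j = MvPolynomial.eval x (F j)) (u w : Fin m → MvPolynomial (Fin k) ℂ)
    (hinv : ∀ x ∈ S, ∀ i, x i * MvPolynomial.eval (f x) (w i) = MvPolynomial.eval (f x) (u i))
    {x₀ : Fin m → ℂ} (hx₀ : x₀ ∈ S) (hw : ∀ i, MvPolynomial.eval (f x₀) (w i) ≠ 0) :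
    IsBirationalOntoImage (zariskiClosure S) f := by
  have hcomp : ∀ (x : Fin m → ℂ) (p : MvPolynomial (Fin k) ℂ),
      MvPolynomial.eval x (MvPolynomial.bind₁ F p) = MvPolynomial.eval (f x) p := by
    intro x p
    rw [show f x = fun j => MvPolynomial.aeval x (F j) from funext (hf x)]
    exact MvPolynomial.aeval_bind₁ _ _ _
  have hV : ∀ x ∈ zariskiClosure S, ∀ i,
      x i * MvPolynomial.eval (f x) (w i) = MvPolynomial.eval (f x) (u i) := by
    intro x hx i
    have := mem_zariskiClosure_iff.mp hx
      (MvPolynomial.X i * MvPolynomial.bind₁ F (w i) - MvPolynomial.bind₁ F (u i)) fun y hy => by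
        simp only [map_sub, map_mul, hcomp, MvPolynomial.eval_X, hinv y hy i, sub_self]
    simp only [map_sub, map_mul, hcomp, MvPolynomial.eval_X] at this
    exact sub_eq_zero.mp this
  have hVdiv : ∀ x ∈ zariskiClosure S, (∀ i, MvPolynomial.eval (f x) (w i) ≠ 0) →
      (fun i => MvPolynomial.eval (f x) (u i) / MvPolynomial.eval (f x) (w i)) = x :=
    fun x hx h => funext fun i => by rw [div_eq_iff (h i), hV x hx i]
  refine ⟨u, w, ⟨f x₀, subset_zariskiClosure _ ⟨x₀, subset_zariskiClosure _ hx₀, rfl⟩, hw⟩,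
    hVdiv, fun y hy hwy => ?_⟩
  -- An identity `g = h ∘ f` on the source becomes `g ∘ ρ = h` on the target, with `ρ = u / w`.
  -- Taking `h = 0` shows that `ρ(y)` lies in the closure of `S`, and `g = F j` shows that `f (ρ(y))
  -- = y`.
  have key : ∀ (g : MvPolynomial (Fin m) ℂ) (h : MvPolynomial (Fin k) ℂ),
      (∀ x ∈ zariskiClosure S, MvPolynomial.eval x g = MvPolynomial.eval (f x) h) →
      MvPolynomial.eval (fun i => MvPolynomial.eval y (u i) / MvPolynomial.eval y (w i)) g
        = MvPolynomial.eval y h := by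
    intro g h hgh
    obtain ⟨N, G, hG⟩ := exists_clear_denominators (K := ℂ) u w g
    have hG' : ∀ z : Fin k → ℂ, (∀ i, MvPolynomial.eval z (w i) ≠ 0) →
        MvPolynomial.eval z G = (∏ i, MvPolynomial.eval z (w i)) ^ N *
          MvPolynomial.eval (fun i => MvPolynomial.eval z (u i) / MvPolynomial.eval z (w i)) g := by
      intro z hz
      simpa [MvPolynomial.coe_aeval_eq_eval] using hG (MvPolynomial.aeval z)
        (by simpa [MvPolynomial.coe_aeval_eq_eval] using hz)
    -- The additional factor `∏ wᵢ` makes the polynomial vanish also at image points where `ρ` is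
    -- undefined.
    have := mem_zariskiClosure_iff.mp hy ((G - (∏ i, w i) ^ N * h) * ∏ i, w i) (by
      rintro _ ⟨x, hx, rfl⟩
      by_cases hz : ∀ i, MvPolynomial.eval (f x) (w i) ≠ 0
      · rw [map_mul, map_sub, hG' _ hz, hVdiv x hx hz, hgh x hx]
        simp
      · push Not at hz
        obtain ⟨i, hi⟩ := hz
        rw [map_mul, map_prod, Finset.prod_eq_zero
          (f := fun i => MvPolynomial.eval (f x) (w i)) (Finset.mem_univ i) hi, mul_zero])
    have hprod : ∏ i, MvPolynomial.eval y (w i) ≠ 0 := Finset.prod_ne_zero_iff.mpr fun i _ => hwy i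
    rw [map_mul, map_prod, mul_eq_zero, or_iff_left hprod, map_sub, hG' _ hwy, map_mul, map_pow,
      map_prod, ← mul_sub, mul_eq_zero, or_iff_right (pow_ne_zero _ hprod)] at this
    exact sub_eq_zero.mp this
  refine ⟨mem_zariskiClosure_iff.mpr fun g hg => ?_, funext fun j => ?_⟩
  · rw [key g 0 fun x hx => by rw [mem_zariskiClosure_iff.mp hx g hg, map_zero], map_zero]
  · rw [hf, key (F j) (MvPolynomial.X j) fun x _ => by rw [MvPolynomial.eval_X, hf],
      MvPolynomial.eval_X]

/-! ### Coordinates of a parametrization: zeros, poles and transcendental parameters -/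

namespace RatParam

/-- The numerator of `p(s)/q(s) - p(t)/q(t)`. -/
def cross {K : Type*} [Field K] {n : ℕ} (φ : RatParam n) (i : Fin n) (s t : K) : K :=
  aeval s (φ.num i) * aeval t (φ.den i) - aeval t (φ.num i) * aeval s (φ.den i)

lemma eval_eq_of_cross_eq_zero {K : Type*} [Field K] {n : ℕ} {φ : RatParam n} {i : Fin n} {s t : K}
    (hs : aeval s (φ.den i) ≠ 0) (ht : aeval t (φ.den i) ≠ 0) (h : φ.cross i s t = 0) :
    φ.eval s i = φ.eval t i := by
  rw [eval, eval, div_eq_div_iff hs ht]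
  exact sub_eq_zero.mp h

variable {n : ℕ} {φ : RatParam n}

lemma IsReduced.not_both_zero (hφ : φ.IsReduced) {K : Type*} [Field K] [CharZero K] (i : Fin n)
    (t : K) : ¬ (aeval t (φ.num i) = 0 ∧ aeval t (φ.den i) = 0) := by
  rintro ⟨h1, h2⟩
  obtain ⟨a, b, hab⟩ := (hφ i).2
  have := congrArg (aeval t) hab
  rw [map_add, map_mul, map_mul, map_one, ← algebraMap_int_eq, aeval_map_algebraMap,
    aeval_map_algebraMap, h1, h2] at this
  simp at this

/-- A nontrivial combination of the numerator and denominator of a nonconstant coordinate is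
nonzero. -/
lemma NoConstantCoord.comb_ne_zero (hc : φ.NoConstantCoord) (hr : φ.IsReduced) {K : Type*} [Field K]
    [CharZero K] (i : Fin n) {α β : K} (h : ¬ (α = 0 ∧ β = 0)) :
    C α * (φ.num i).map (algebraMap ℤ K) + C β * (φ.den i).map (algebraMap ℤ K) ≠ 0 := by
  intro h0
  have hco : ∀ j, α * ((φ.num i).coeff j : K) + β * ((φ.den i).coeff j : K) = 0 := fun j => by
    simpa using congrArg (coeff · j) h0
  obtain ⟨j, hj⟩ : ∃ j, (φ.den i).coeff j ≠ 0 := by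
    by_contra! hall
    exact (hr i).1 (Polynomial.ext (by simpa using hall))
  have hjK : ((φ.den i).coeff j : K) ≠ 0 := by exact_mod_cast hj
  have hjQ : ((φ.den i).coeff j : ℚ) ≠ 0 := by exact_mod_cast hj
  have hα : α ≠ 0 := by
    rintro rfl
    have := hco j
    rw [zero_mul, zero_add, mul_eq_zero, or_iff_left hjK] at this
    exact h ⟨rfl, this⟩
  -- A linear relation over `K` between integer polynomials makes them proportional, and the factor
  -- is a ratio of integer coefficients.
  refine hc i ⟨(φ.num i).coeff j / (φ.den i).coeff j, Polynomial.ext fun l => ?_⟩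
  have hprod : (φ.num i).coeff l * (φ.den i).coeff j = (φ.num i).coeff j * (φ.den i).coeff l := by
    have : α * ((φ.num i).coeff l * (φ.den i).coeff j : K)
        = α * ((φ.num i).coeff j * (φ.den i).coeff l) := by
      linear_combination ((φ.den i).coeff j : K) * hco l - ((φ.den i).coeff l : K) * hco j
    exact_mod_cast mul_left_cancel₀ hα this
  simp only [coeff_map, coeff_C_mul, eq_intCast]
  field_simp
  exact_mod_cast hprod

lemma NoConstantCoord.finite_comb_zeros (hc : φ.NoConstantCoord) (hr : φ.IsReduced) (i : Fin n)
    {α β : ℂ} (h : ¬ (α = 0 ∧ β = 0)) :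
    {t : ℂ | α * aeval t (φ.num i) + β * aeval t (φ.den i) = 0}.Finite := by
  refine (Multiset.finite_toSet (C α * (φ.num i).map (algebraMap ℤ ℂ) +
    C β * (φ.den i).map (algebraMap ℤ ℂ)).roots).subset fun t ht => ?_
  rw [Set.mem_ofPred_eq, mem_roots (hc.comb_ne_zero hr i h), IsRoot]
  simp only [eval_add, eval_mul, eval_C, eval_map_algebraMap]
  exact ht

lemma IsReduced.finite_poles (hr : φ.IsReduced) : {t : ℂ | φ.IsPole t}.Finite := by
  have : {t : ℂ | φ.IsPole t} = ⋃ i, {t : ℂ | aeval t (φ.den i) = 0} := by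
    ext t; simp [IsPole]
  rw [this]
  refine Set.finite_iUnion fun i => ?_
  refine (Multiset.finite_toSet ((φ.den i).map (algebraMap ℤ ℂ)).roots).subset fun t ht => ?_
  rw [Set.mem_ofPred_eq, mem_roots ((Polynomial.map_ne_zero_iff (algebraMap ℤ ℂ).injective_int).mpr (hr i).1),
    IsRoot, eval_map_algebraMap]
  exact ht

lemma not_isPole_of_transcendental (hr : φ.IsReduced) {t : ℂ} (ht : Transcendental ℤ t) :
    ¬ φ.IsPole t := by
  rintro ⟨i, hi⟩
  exact (hr i).1 (transcendental_iff.mp ht _ hi)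

/-- A polynomial relation over `ℚ` that holds at one transcendental parameter holds at all of
them. -/
lemma aeval_eval_eq_zero_of_transcendental {t₀ : ℂ} (ht₀ : Transcendental ℚ t₀)
    (ht₀' : ¬ φ.IsPole t₀)
    {g : MvPolynomial (Fin n) ℚ} (hg : MvPolynomial.aeval (φ.eval t₀) g = 0) {t : ℂ}
    (ht : ¬ φ.IsPole t) : MvPolynomial.aeval (φ.eval t) g = 0 := by
  obtain ⟨N, G, hG⟩ := exists_clear_denominators (K := ℂ) (R := ℚ[X])
    (fun i => (φ.num i).map (algebraMap ℤ ℚ)) (fun i => (φ.den i).map (algebraMap ℤ ℚ)) g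
  have hG' : ∀ s : ℂ, ¬ φ.IsPole s →
      aeval s G = (∏ i, aeval s (φ.den i)) ^ N * MvPolynomial.aeval (φ.eval s) g := by
    intro s hs
    have := hG (aeval s) (by
      simp only [aeval_map_algebraMap]
      exact fun i hi => hs ⟨i, hi⟩)
    simp only [aeval_map_algebraMap] at this
    exact this
  -- With denominators cleared the relation is a rational polynomial in `t` alone; having a
  -- transcendental root, it is zero.
  have h0 : G = 0 := transcendental_iff.mp ht₀ G (by rw [hG' t₀ ht₀', hg, mul_zero])
  have := hG' t ht
  rw [h0, map_zero, eq_comm, mul_eq_zero, or_iff_right] at this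
  · exact this
  · exact pow_ne_zero _ (Finset.prod_ne_zero_iff.mpr fun i _ hi => ht ⟨i, hi⟩)

end RatParam

/-- An element algebraic over `k`, all of whose conjugates coincide with it, lies in `k`. -/
lemma mem_range_of_unique_conjugate {k K : Type*} [Field k] [CharZero k] [Field K] [IsAlgClosed K]
    [Algebra k K] {t : K} (ht : IsIntegral k t) (h : ∀ s : K, aeval s (minpoly k t) = 0 → s = t) :
    t ∈ (algebraMap k K).range := by
  rw [← minpoly.natDegree_eq_one_iff]
  refine le_antisymm ?_ (minpoly.natDegree_pos ht)
  rw [← card_rootSet_eq_natDegree (K := K) (minpoly.irreducible ht).separable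
    (IsAlgClosed.splits _), Fintype.card_le_one_iff]
  rintro ⟨x, hx⟩ ⟨y, hy⟩
  simp only [Subtype.mk.injEq]
  rw [h x (aeval_eq_zero_of_mem_rootSet hx), h y (aeval_eq_zero_of_mem_rootSet hy)]

/-! ### Birationality from separation at one transcendental parameter -/

namespace RatParam

lemma image_nonpole {n : ℕ} {φ : RatParam n} {t : ℂ} (ht : ¬ φ.IsPole t) : φ.eval t ∈ φ.image :=
  ⟨t, ht, rfl⟩

/-- If for some transcendental parameter `t₀` the first coordinate and `y + a z` jointly separate
`t₀` from all other points, then the projection is birational. -/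
theorem isBirational_of_separating {φ : RatParam 3} (hr : φ.IsReduced) (hc : φ.NoConstantCoord)
    (a : ℤ) {t₀ : ℂ} (ht₀ : Transcendental ℚ t₀) (hpole : ¬ φ.IsPole t₀)
    (hsep : ∀ s : ℂ, φ.cross 0 s t₀ = 0 →
      φ.cross 1 s t₀ * (aeval s (φ.den 2) * aeval t₀ (φ.den 2)) +
        a * (φ.cross 2 s t₀ * (aeval s (φ.den 1) * aeval t₀ (φ.den 1))) = 0 → s = t₀) :
    IsBirationalOntoImage φ.complexCurve (shearProj a) := by
  have hd : ∀ i, aeval t₀ (φ.den i) ≠ 0 := fun i hi => hpole ⟨i, hi⟩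
  set ψ : Fin 2 → ℂ := shearProj a (φ.eval t₀) with hψ
  let k := IntermediateField.adjoin ℚ (Set.range ψ)
  have hψk : ∀ j, ψ j ∈ k := fun j => IntermediateField.subset_adjoin ℚ _ ⟨j, rfl⟩
  have hψ0 : ψ 0 * aeval t₀ (φ.den 0) = aeval t₀ (φ.num 0) := by
    simp only [hψ, shearProj, eval, Matrix.cons_val_zero]
    exact div_mul_cancel₀ _ (hd 0)
  have hψ1 : ψ 1 * (aeval t₀ (φ.den 1) * aeval t₀ (φ.den 2)) =
      aeval t₀ (φ.num 1) * aeval t₀ (φ.den 2) + a * (aeval t₀ (φ.num 2) * aeval t₀ (φ.den 1)) := by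
    have h1 := hd 1
    have h2 := hd 2
    simp only [hψ, shearProj, eval, Matrix.cons_val_one, Matrix.cons_val_fin_one]
    field_simp
  -- the two polynomials over `k` whose common roots are the points of the fibre
  set P : k[X] := C 1 * (φ.num 0).map (algebraMap ℤ k) +
    C (-⟨ψ 0, hψk 0⟩) * (φ.den 0).map (algebraMap ℤ k) with hP
  set Q : k[X] := (φ.num 1 * φ.den 2 + C a * (φ.num 2 * φ.den 1)).map (algebraMap ℤ k) -
    C ⟨ψ 1, hψk 1⟩ * (φ.den 1 * φ.den 2).map (algebraMap ℤ k) with hQ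
  have hPs : ∀ s : ℂ, aeval s P = aeval s (φ.num 0) - ψ 0 * aeval s (φ.den 0) := by
    intro s
    simp only [hP, map_add, map_mul, aeval_C, aeval_map_algebraMap, map_one, map_neg]
    simp only [IntermediateField.algebraMap_apply]
    ring
  have hQs : ∀ s : ℂ, aeval s Q = aeval s (φ.num 1) * aeval s (φ.den 2) +
      a * (aeval s (φ.num 2) * aeval s (φ.den 1)) -
      ψ 1 * (aeval s (φ.den 1) * aeval s (φ.den 2)) := by
    intro s
    simp only [hQ, map_sub, aeval_map_algebraMap, map_add, map_mul, aeval_C]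
    simp [IntermediateField.algebraMap_apply]
  have hP0 : aeval t₀ P = 0 := by rw [hPs, hψ0, sub_self]
  have hQ0 : aeval t₀ Q = 0 := by rw [hQs, hψ1, sub_self]
  have hPne : P ≠ 0 := hc.comb_ne_zero hr 0 (by simp)
  have hint : IsIntegral k t₀ := isAlgebraic_iff_isIntegral.mp ⟨P, hPne, hP0⟩
  -- A conjugate of `t₀` over `k` is a common root of `P` and `Q`; clearing denominators puts it
  -- under `hsep`, so it equals `t₀`.
  have ht₀k : t₀ ∈ (algebraMap k ℂ).range := by
    refine mem_range_of_unique_conjugate hint fun s hs => hsep s ?_ ?_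
    · obtain ⟨R, hR⟩ := minpoly.dvd k t₀ hP0
      have h : aeval s P = 0 := by rw [hR, map_mul, hs, zero_mul]
      rw [hPs] at h
      rw [cross, ← hψ0]
      linear_combination (aeval t₀ (φ.den 0)) * h
    · obtain ⟨R, hR⟩ := minpoly.dvd k t₀ hQ0
      have h : aeval s Q = 0 := by rw [hR, map_mul, hs, zero_mul]
      rw [hQs] at h
      rw [cross, cross]
      linear_combination (aeval t₀ (φ.den 1) * aeval t₀ (φ.den 2)) * h +
        (aeval s (φ.den 1) * aeval s (φ.den 2)) * hψ1
  obtain ⟨τ, hτ⟩ := ht₀k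
  have hφk : ∀ i, ∃ u w : MvPolynomial (Fin 2) ℚ, MvPolynomial.aeval ψ w ≠ 0 ∧
      φ.eval t₀ i * MvPolynomial.aeval ψ w = MvPolynomial.aeval ψ u := by
    intro i
    have hmem : φ.eval t₀ i ∈ k := by
      have : φ.eval t₀ i = algebraMap k ℂ (φ.eval τ i) := by
        rw [eval, eval, map_div₀, ← hτ, aeval_algebraMap_apply, aeval_algebraMap_apply]
      rw [this]
      exact (φ.eval τ i).2
    obtain ⟨u, w, huw⟩ := (IntermediateField.mem_adjoin_range_iff ℚ ψ _).mp hmem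
    -- The fraction for a member of `k` may have a vanishing denominator, in which case its value is
    -- `0` by convention; `0 / 1` replaces it.
    by_cases hw : MvPolynomial.aeval ψ w = 0
    · exact ⟨0, 1, by simp, by rw [huw, hw]; simp⟩
    · exact ⟨u, w, hw, by rw [huw, div_mul_cancel₀ _ hw]⟩
  choose u w hw huw using hφk
  -- The projection is needed over `ℚ`, where relations pass from `t₀` to all parameters, and over
  -- `ℂ`, where birationality is stated.
  let F : (R : Type) → [CommRing R] → Fin 2 → MvPolynomial (Fin 3) R := fun R _ =>
    ![MvPolynomial.X 0, MvPolynomial.X 1 + (a : MvPolynomial (Fin 3) R) * MvPolynomial.X 2]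
  have hF : ∀ (x : Fin 3 → ℂ) (j : Fin 2), shearProj a x j = MvPolynomial.aeval x (F ℚ j) := by
    intro x j
    fin_cases j <;> simp [shearProj, F]
  refine isBirationalOntoImage_of_rational_inverse (F ℂ)
    (fun x j => by fin_cases j <;> simp [shearProj, F])
    (fun i => (u i).map (algebraMap ℚ ℂ)) (fun i => (w i).map (algebraMap ℚ ℂ)) ?_
    (image_nonpole hpole) ?_
  · rintro _ ⟨t, ht, rfl⟩ i
    have hcomp : ∀ (x : Fin 3 → ℂ) (p : MvPolynomial (Fin 2) ℚ),
        MvPolynomial.aeval x (MvPolynomial.bind₁ (F ℚ) p) =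
          MvPolynomial.aeval (shearProj a x) p := by
      intro x p
      rw [show shearProj a x = _ from funext (hF x)]
      exact MvPolynomial.aeval_bind₁ _ _ _
    have := aeval_eval_eq_zero_of_transcendental ht₀ hpole
      (g := MvPolynomial.X i * MvPolynomial.bind₁ (F ℚ) (w i) - MvPolynomial.bind₁ (F ℚ) (u i))
      (by rw [map_sub, map_mul, hcomp, hcomp, MvPolynomial.aeval_X, huw i, sub_self]) ht
    rw [map_sub, map_mul, hcomp, hcomp, MvPolynomial.aeval_X] at this
    simpa [MvPolynomial.eval_map, MvPolynomial.aeval_def] using sub_eq_zero.mp this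
  · intro i
    simpa [MvPolynomial.eval_map, MvPolynomial.aeval_def] using hw i

/-- A proper parametrization has transcendental parameters whose fibre for `φ`, and for the
first coordinate, is as expected. -/
lemma exists_generic_parameter {φ : RatParam 3} (hr : φ.IsReduced) (hc : φ.NoConstantCoord)
    (hp : φ.IsProper) : ∃ t₀ : ℂ, Transcendental ℤ t₀ ∧
      (∀ s, ¬ φ.IsPole s → φ.eval s = φ.eval t₀ → s = t₀) ∧
      (∀ s, φ.IsPole s → φ.cross 0 s t₀ ≠ 0) := by
  set bad := {x | x ∈ φ.complexCurve ∧ ¬ ∃! t : ℂ, ¬ φ.IsPole t ∧ φ.eval t = x} with hbad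
  -- `h1` collects the parameters sharing their first coordinate with one of the finitely many
  -- points having a wrong fibre, `h2` those for which some pole solves the cleared equation of the
  -- first coordinate. Both sets are finite and the algebraic numbers are countable, so a parameter
  -- outside all three exists.
  have h1 : (⋃ x ∈ bad, {t : ℂ | 1 * aeval t (φ.num 0) + (-x 0) * aeval t (φ.den 0) = 0}).Finite :=
    Set.Finite.biUnion hp fun x _ => hc.finite_comb_zeros hr 0 (by simp)
  have h2 : (⋃ s ∈ {s : ℂ | φ.IsPole s},
      {t : ℂ | (-aeval s (φ.den 0)) * aeval t (φ.num 0) +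
        aeval s (φ.num 0) * aeval t (φ.den 0) = 0}).Finite :=
    Set.Finite.biUnion hr.finite_poles fun s _ => hc.finite_comb_zeros hr 0 (by
      rintro ⟨h, h'⟩
      exact hr.not_both_zero 0 s ⟨h', neg_eq_zero.mp h⟩)
  obtain ⟨t₀, ht₀⟩ : ∃ t₀ : ℂ, t₀ ∉ {x : ℂ | IsAlgebraic ℤ x} ∪ (_ ∪ _) := by
    by_contra! hall
    exact not_countable_complex ((((Algebraic.countable ℤ ℂ).union
      (h1.countable.union h2.countable))).mono fun x _ => hall x)
  rw [Set.mem_union, Set.mem_union, not_or, not_or] at ht₀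
  obtain ⟨htr, hb, hq⟩ := ht₀
  have htr' : Transcendental ℤ t₀ := htr
  have hpole := not_isPole_of_transcendental hr htr'
  refine ⟨t₀, htr', fun s hs hst => ?_, fun s hs h0 => ?_⟩
  · have hnb : φ.eval t₀ ∉ bad := fun hmem => hb (by
      refine Set.mem_biUnion hmem ?_
      show 1 * aeval t₀ (φ.num 0) + (-(φ.eval t₀ 0)) * aeval t₀ (φ.den 0) = 0
      rw [eval, one_mul, neg_mul, div_mul_cancel₀ _ fun hi => hpole ⟨0, hi⟩, add_neg_cancel])
    have hex : ∃! t : ℂ, ¬ φ.IsPole t ∧ φ.eval t = φ.eval t₀ := by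
      by_contra hne
      exact hnb ⟨subset_zariskiClosure _ (image_nonpole hpole), hne⟩
    exact hex.unique ⟨hs, hst⟩ ⟨hpole, rfl⟩
  · refine hq (Set.mem_biUnion (show s ∈ {s : ℂ | φ.IsPole s} from hs) ?_)
    show (-aeval s (φ.den 0)) * aeval t₀ (φ.num 0) + aeval s (φ.num 0) * aeval t₀ (φ.den 0) = 0
    rw [← h0, cross]
    ring

end RatParam

/-! ### Integer norms and birationality for large `|a|` -/

/-- The `ℓ¹` norm of an integer polynomial. -/
def intLOne : RingSeminorm ℤ[X] := lOne (normRingSeminorm ℤ)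

lemma normRingSeminorm_int_one : normRingSeminorm ℤ 1 ≤ 1 := (norm_one (α := ℤ)).le

lemma intLOne_one : intLOne 1 ≤ 1 := by
  rw [intLOne, ← C_1, lOne_C]
  exact normRingSeminorm_int_one

lemma abs_le_normRingSeminorm_of_dvd {a r : ℤ} (hr : r ≠ 0) (h : a ∣ r) :
    (|a| : ℤ) ≤ normRingSeminorm ℤ r := by
  have := Int.le_of_dvd (abs_pos.mpr hr) ((abs_dvd_abs a r).mpr h)
  refine (Int.cast_le (R := ℝ).mpr this).trans (le_of_eq ?_)
  rw [Int.cast_abs]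
  exact (Int.norm_eq_abs r).symm

/-- A constant dividing a polynomial divides all its coefficients, in particular the leading one. -/
lemma abs_le_intLOne_of_dvd {a : ℤ} {r : ℤ[X]} (hr : r ≠ 0) (h : C a ∣ r) :
    (|a| : ℤ) ≤ intLOne r :=
  (abs_le_normRingSeminorm_of_dvd (leadingCoeff_ne_zero.mpr hr)
    ((C_dvd_iff_dvd_coeff a r).mp h _)).trans (coeff_le_lOne _ r _)

namespace RatParam

/-- All the polynomials of `φ` have degree at most `d` and `ℓ¹` norm at most `T`. -/
def HasNormBound {n : ℕ} (φ : RatParam n) (d : ℕ) (T : ℝ) : Prop :=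
  ∀ i, ((φ.num i).natDegree ≤ d ∧ intLOne (φ.num i) ≤ T) ∧
    ((φ.den i).natDegree ≤ d ∧ intLOne (φ.den i) ≤ T)

/-- The numerator of `p(s)/q(s) - p(t)/q(t)`, as a polynomial in `s` over `ℤ[t]`. -/
def crossPoly {n : ℕ} (φ : RatParam n) (i : Fin n) : ℤ[X][X] :=
  (φ.num i).map C * C (φ.den i) - C (φ.num i) * (φ.den i).map C

lemma eval₂_map_C (p : ℤ[X]) (s t : ℂ) :
    (p.map (C : ℤ →+* ℤ[X])).eval₂ (aeval t : ℤ[X] →ₐ[ℤ] ℂ).toRingHom s = aeval s p := by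
  rw [eval₂_map, aeval_def]
  congr 1
  ext; simp

variable {n : ℕ} {φ : RatParam n}

lemma eval₂_crossPoly (i : Fin n) (s t : ℂ) :
    (φ.crossPoly i).eval₂ (aeval t : ℤ[X] →ₐ[ℤ] ℂ).toRingHom s = φ.cross i s t := by
  rw [crossPoly, eval₂_sub, eval₂_mul, eval₂_mul, eval₂_map_C, eval₂_map_C, eval₂_C, eval₂_C]
  rfl

lemma lOne_map_C_le (p : ℤ[X]) : lOne intLOne (p.map C) ≤ intLOne p :=
  lOne_map_le _ _ _ (fun x => (lOne_C _ x).le) p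

lemma natDegree_crossPoly_le {d : ℕ} {T : ℝ} (h : φ.HasNormBound d T) (i : Fin n) :
    (φ.crossPoly i).natDegree ≤ d := by
  refine (natDegree_sub_le _ _).trans (max_le ?_ ?_)
  · exact (natDegree_mul_C_le _ _).trans (natDegree_map_le.trans (h i).1.1)
  · exact (natDegree_C_mul_le _ _).trans (natDegree_map_le.trans (h i).2.1)

lemma lOne_crossPoly_le {d : ℕ} {T : ℝ} (h : φ.HasNormBound d T) (i : Fin n) :
    lOne intLOne (φ.crossPoly i) ≤ 2 * T ^ 2 := by
  have hn := (h i).1.2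
  have hd := (h i).2.2
  have h1 := lOne_map_C_le (φ.num i)
  have h2 := lOne_map_C_le (φ.den i)
  have e1 : lOne intLOne ((φ.num i).map C * C (φ.den i)) ≤ T * T := by
    refine (map_mul_le_mul _ _ _).trans ?_
    rw [lOne_C]
    exact mul_le_mul (h1.trans hn) hd (apply_nonneg _ _) ((apply_nonneg _ _).trans hn)
  have e2 : lOne intLOne (C (φ.num i) * (φ.den i).map C) ≤ T * T := by
    refine (map_mul_le_mul _ _ _).trans ?_
    rw [lOne_C]
    exact mul_le_mul hn (h2.trans hd) (apply_nonneg _ _) ((apply_nonneg _ _).trans hn)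
  rw [crossPoly]
  linarith [map_sub_le_add (lOne intLOne) ((φ.num i).map C * C (φ.den i))
    (C (φ.num i) * (φ.den i).map C)]

/-- `crossPoly i` multiplied by another denominator at both parameters. -/
lemma crossPoly_mul_den_bounds {d : ℕ} {T : ℝ} (h : φ.HasNormBound d T) (i j : Fin n) :
    (φ.crossPoly i * ((φ.den j).map C * C (φ.den j))).natDegree ≤ 2 * d ∧
      lOne intLOne (φ.crossPoly i * ((φ.den j).map C * C (φ.den j))) ≤ 2 * T ^ 4 := by
  have hd := (h j).2.2
  constructor
  · rw [two_mul]
    exact natDegree_mul_le_of_le (natDegree_crossPoly_le h i)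
      ((natDegree_mul_C_le _ _).trans (natDegree_map_le.trans (h j).2.1))
  · have e1 : lOne intLOne ((φ.den j).map C * C (φ.den j)) ≤ T * T := by
      refine (map_mul_le_mul _ _ _).trans ?_
      rw [lOne_C]
      exact mul_le_mul ((lOne_map_C_le _).trans hd) hd (apply_nonneg _ _)
        ((apply_nonneg _ _).trans hd)
    refine (map_mul_le_mul _ _ _).trans ((mul_le_mul (lOne_crossPoly_le h i) e1
      (apply_nonneg _ _) (by positivity)).trans (le_of_eq (by ring)))

/-- For large `|a|` the projection is birational. -/
theorem isBirational_of_large {φ : RatParam 3} (hr : φ.IsReduced) (hc : φ.NoConstantCoord)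
    (hp : φ.IsProper) {d : ℕ} {T : ℝ} (hT : 1 ≤ T) (h : φ.HasNormBound d T) {a : ℤ}
    (ha : ((3 * d).factorial : ℝ) * (5 * T ^ 4) ^ (3 * d) < (|a| : ℤ)) :
    IsBirationalOntoImage φ.complexCurve (shearProj a) := by
  obtain ⟨t₀, ht₀, hfib, hpoles⟩ := exists_generic_parameter hr hc hp
  have hpole := not_isPole_of_transcendental hr ht₀
  have ht₀Q : Transcendental ℚ t₀ := fun hal => ht₀ ((IsFractionRing.isAlgebraic_iff ℤ ℚ ℂ).mpr hal)
  refine isBirational_of_separating hr hc a ht₀Q hpole fun s h0 h12 => ?_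
  by_contra hst
  have hs : ¬ φ.IsPole s := fun hs => hpoles s hs h0
  have hds : ∀ i, aeval s (φ.den i) ≠ 0 := fun i hi => hs ⟨i, hi⟩
  have hdt : ∀ i, aeval t₀ (φ.den i) ≠ 0 := fun i hi => hpole ⟨i, hi⟩
  set σ : ℤ[X] →+* ℂ := (aeval t₀ : ℤ[X] →ₐ[ℤ] ℂ).toRingHom with hσ
  have hσinj : Function.Injective σ := transcendental_iff_injective.mp ht₀
  have hev : ∀ i j, (φ.crossPoly i * ((φ.den j).map C * C (φ.den j))).eval₂ σ s =
      φ.cross i s t₀ * (aeval s (φ.den j) * aeval t₀ (φ.den j)) := by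
    intro i j
    rw [eval₂_mul, eval₂_mul, eval₂_crossPoly, eval₂_map_C, eval₂_C]
    rfl
  have hf0 : φ.crossPoly 0 ≠ 0 := by
    intro hz
    have hcomb := hc.comb_ne_zero hr 0 (α := aeval t₀ (φ.den 0)) (β := -aeval t₀ (φ.num 0))
      fun hh => hdt 0 hh.1
    refine hcomb (Polynomial.funext fun x => ?_)
    have := eval₂_crossPoly (φ := φ) 0 x t₀
    rw [hz, eval₂_zero, cross] at this
    simp only [eval_add, eval_mul, eval_C, eval_map_algebraMap, eval_zero]
    rw [this]
    ring
  have ha0 : a ≠ 0 := by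
    rintro rfl
    have : (0 : ℝ) ≤ ((3 * d).factorial : ℝ) * (5 * T ^ 4) ^ (3 * d) := by positivity
    simp at ha
    linarith
  have hT2 : T ^ 2 ≤ T ^ 4 := pow_le_pow_right₀ hT (by norm_num)
  have hT4 : 1 ≤ T ^ 4 := one_le_pow₀ hT
  -- Here `A = ℤ[t]`, embedded in `ℂ` by `t ↦ t₀`. The pencil is the difference of `y + a z` at `s`
  -- and `t`, cleared of denominators. The constant is `5 = 2 + 2 + 1`, and the Sylvester matrix has
  -- size at most `d + 2 d`.
  obtain ⟨r, hr0, hdvd, hle⟩ := exists_dvd_of_pencil_root intLOne intLOne_one hσinj hf0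
    (crossPoly_mul_den_bounds h 1 2).1 (crossPoly_mul_den_bounds h 2 1).1 (B := 5 * T ^ 4)
    ((lOne_crossPoly_le h 0).trans (by linarith))
    (by linarith [(crossPoly_mul_den_bounds h 1 2).2, (crossPoly_mul_den_bounds h 2 1).2])
    (s := s) (by rw [eval₂_crossPoly, h0]) (by
      rw [hev, hev]
      rintro ⟨h1, h2⟩
      -- If `g` and `h` both vanished, all three coordinates would agree at `s` and `t₀`, against
      -- the choice of `t₀`.
      rw [mul_eq_zero, or_iff_left (mul_ne_zero (hds _) (hdt _))] at h1 h2
      refine hst (hfib s hs (funext fun i => eval_eq_of_cross_eq_zero (hds i) (hdt i) ?_))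
      fin_cases i
      exacts [h0, h1, h2])
    (a := C a) (C_ne_zero.mpr ha0) (by
      rw [hev, hev, show σ (C a) = (a : ℂ) by simp [hσ]]
      exact h12)
  have hN : (φ.crossPoly 0).natDegree + 2 * d ≤ 3 * d := by
    linarith [natDegree_crossPoly_le h 0]
  refine absurd ((abs_le_intLOne_of_dvd hr0 hdvd).trans (hle.trans ?_)) (not_le.mpr ha)
  exact mul_le_mul (by exact_mod_cast Nat.factorial_le hN)
    (pow_le_pow_right₀ (by linarith) hN) (by positivity) (by positivity)

end RatParam

/-! ### Hasse derivatives -/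

/-- Each coefficient is only multiplied by a binomial coefficient, at most `2 ^ d`. -/
lemma intLOne_hasseDeriv_le (p : ℤ[X]) {d : ℕ} (hd : p.natDegree ≤ d) (m : ℕ) :
    intLOne (hasseDeriv m p) ≤ 2 ^ d * intLOne p := by
  rw [hasseDeriv_apply, Polynomial.sum_def]
  refine (Finset.le_sum_of_subadditive intLOne (map_zero _).le (map_add_le_add _) _ _).trans ?_
  rw [intLOne, lOne_apply, Finset.mul_sum]
  refine Finset.sum_le_sum fun i hi => ?_
  rw [show lOne (normRingSeminorm ℤ) (monomial (i - m) ((i.choose m : ℤ) * p.coeff i)) = _ from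
    coeffSum_monomial _ _ _]
  refine (map_mul_le_mul _ _ _).trans (mul_le_mul_of_nonneg_right ?_ (apply_nonneg _ _))
  have h1 : i.choose m ≤ 2 ^ d := (Nat.choose_le_two_pow i m).trans
    (Nat.pow_le_pow_right two_pos ((le_natDegree_of_mem_supp i hi).trans hd))
  calc normRingSeminorm ℤ (i.choose m : ℤ) = ((i.choose m : ℕ) : ℝ) := Int.norm_natCast _
    _ ≤ 2 ^ d := by exact_mod_cast h1

lemma map_hasseDeriv {A B : Type*} [CommRing A] [CommRing B] (σ : A →+* B) (m : ℕ) (p : A[X]) :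
    (hasseDeriv m p).map σ = hasseDeriv m (p.map σ) := by
  ext i
  simp [hasseDeriv_coeff]

/-- The cofactor `r` of a power of `X - t` has no integer coefficients in general, whereas the Hasse
derivative of an integer polynomial does, and both have the same value at `t`. -/
lemma eval_hasseDeriv_of_eq_pow_mul {A : Type*} [CommRing A] {p r : A[X]} {t : A} {m : ℕ}
    (h : p = (X - C t) ^ m * r) : (hasseDeriv m p).eval t = r.eval t := by
  rw [← taylor_coeff, h, taylor_mul, taylor_pow]
  have : taylor t (X - C t) = X := by simp
  rw [this]
  simpa using coeff_X_pow_mul (taylor t r) m 0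

/-! ### Comparing orders of vanishing -/

/-- The factor `0 ^ e` treats equal orders (`e = 0`) and different orders (`e > 0`) in one limit. -/
lemma eval_mul_zero_pow_eq_of_tendsto {A B : ℝ[X]} {e : ℕ} {t₀ c : ℝ} {l : Filter ℝ} [l.NeBot]
    (hl : l ≤ 𝓝 t₀) {ρ : ℝ → ℝ} (hρ : Tendsto ρ l (𝓝 c))
    (h : ∀ᶠ t in l, A.eval t * (t - t₀) ^ e = ρ t * B.eval t) :
    A.eval t₀ * 0 ^ e = c * B.eval t₀ := by
  have h1 : Tendsto (fun t => A.eval t * (t - t₀) ^ e) l (𝓝 (A.eval t₀ * (t₀ - t₀) ^ e)) :=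
    (Continuous.tendsto (by fun_prop) t₀).mono_left hl
  have h2 : Tendsto (fun t => ρ t * B.eval t) l (𝓝 (c * B.eval t₀)) :=
    hρ.mul ((Continuous.tendsto (by fun_prop) t₀).mono_left hl)
  rw [sub_self] at h1
  exact tendsto_nhds_unique (h1.congr' h) h2

/-- As the ratio of the two fractions has a finite nonzero limit and the numerators do not vanish at
`t₀`, the poles have equal order. Comparing the lowest terms gives the final relation. -/
lemma exists_common_order_of_tendsto {p₂ p₃ q₂ q₃ : ℝ[X]} {t₀ c : ℝ} (hc : c ≠ 0)
    {l : Filter ℝ} [l.NeBot] (hl : l ≤ 𝓝[≠] t₀) {ρ : ℝ → ℝ} (hρ : Tendsto ρ l (𝓝 c))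
    (h : ∀ᶠ t in l, p₂.eval t * q₃.eval t = ρ t * (p₃.eval t * q₂.eval t))
    (hp₂ : p₂.eval t₀ ≠ 0) (hp₃ : p₃.eval t₀ ≠ 0) (hq₂ : q₂ ≠ 0) (hq₃ : q₃ ≠ 0) :
    ∃ (m : ℕ) (r₂ r₃ : ℝ[X]), q₂ = (X - C t₀) ^ m * r₂ ∧ q₃ = (X - C t₀) ^ m * r₃ ∧
      r₂.eval t₀ ≠ 0 ∧ p₂.eval t₀ * r₃.eval t₀ = c * (p₃.eval t₀ * r₂.eval t₀) := by
  obtain ⟨r₂, h₂, hr₂⟩ := exists_eq_pow_rootMultiplicity_mul_and_not_dvd q₂ hq₂ t₀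
  obtain ⟨r₃, h₃, hr₃⟩ := exists_eq_pow_rootMultiplicity_mul_and_not_dvd q₃ hq₃ t₀
  set m₂ := rootMultiplicity t₀ q₂
  set m₃ := rootMultiplicity t₀ q₃
  rw [dvd_iff_isRoot, IsRoot] at hr₂ hr₃
  have hl' : l ≤ 𝓝 t₀ := hl.trans nhdsWithin_le_nhds
  have hne : ∀ᶠ t in l, t - t₀ ≠ 0 :=
    hl (eventually_nhdsWithin_of_forall fun t ht => sub_ne_zero.mpr ht)
  have hrel : ∀ᶠ t in l, p₂.eval t * r₃.eval t * (t - t₀) ^ m₃ =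
      ρ t * (p₃.eval t * r₂.eval t) * (t - t₀) ^ m₂ := by
    filter_upwards [h] with t ht
    rw [h₂, h₃] at ht
    simp only [eval_mul, eval_pow, eval_sub, eval_X, eval_C] at ht
    linear_combination ht
  rcases le_total m₂ m₃ with hle | hle
  · obtain ⟨e, he⟩ := Nat.exists_eq_add_of_le hle
    have := eval_mul_zero_pow_eq_of_tendsto (A := p₂ * r₃) (B := p₃ * r₂) (e := e) hl' hρ (by
      filter_upwards [hrel, hne] with t ht hn
      rw [he, pow_add] at ht
      simp only [eval_mul]
      refine mul_right_cancel₀ (pow_ne_zero m₂ hn) ?_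
      linear_combination ht)
    simp only [eval_mul] at this
    rcases Nat.eq_zero_or_pos e with rfl | hpos
    · rw [pow_zero, mul_one] at this
      rw [add_zero] at he
      exact ⟨m₂, r₂, r₃, h₂, he ▸ h₃, hr₂, this⟩
    · rw [zero_pow hpos.ne', mul_zero] at this
      exact absurd this.symm (mul_ne_zero hc (mul_ne_zero hp₃ hr₂))
  · obtain ⟨e, he⟩ := Nat.exists_eq_add_of_le hle
    have := eval_mul_zero_pow_eq_of_tendsto (A := p₃ * r₂) (B := p₂ * r₃) (e := e) hl'
      (hρ.inv₀ hc) (by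
        filter_upwards [hrel, hne, hρ.eventually_ne hc] with t ht hn hρ0
        rw [he, pow_add] at ht
        simp only [eval_mul]
        field_simp
        refine mul_right_cancel₀ (pow_ne_zero m₃ hn) ?_
        linear_combination -ht)
    simp only [eval_mul] at this
    rcases Nat.eq_zero_or_pos e with rfl | hpos
    · rw [pow_zero, mul_one] at this
      rw [add_zero] at he
      refine ⟨m₂, r₂, r₃, h₂, he.symm ▸ h₃, hr₂, ?_⟩
      rw [this]
      field_simp
    · rw [zero_pow hpos.ne', mul_zero] at this
      exact absurd this.symm (mul_ne_zero (inv_ne_zero hc) (mul_ne_zero hp₂ hr₃))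

/-- The limit at infinity of a quotient of integer polynomials, if it is a nonzero integer,
divides the leading coefficient of the numerator. -/
lemma dvd_leadingCoeff_of_tendsto_atTop {P Q : ℤ[X]} (hQ : Q ≠ 0) {c : ℤ}
    (hc : c ≠ 0) (h : Tendsto (fun t : ℝ => aeval t P / aeval t Q) atTop (𝓝 (c : ℝ))) :
    P ≠ 0 ∧ c ∣ P.leadingCoeff := by
  have hinj : Function.Injective (algebraMap ℤ ℝ) := (algebraMap ℤ ℝ).injective_int
  have hc' : (c : ℝ) ≠ 0 := by exact_mod_cast hc
  set P' := P.map (algebraMap ℤ ℝ)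
  set Q' := Q.map (algebraMap ℤ ℝ)
  have hQ' : Q' ≠ 0 := (Polynomial.map_ne_zero_iff hinj).mpr hQ
  have h' : Tendsto (fun t : ℝ => P'.eval t / Q'.eval t) atTop (𝓝 (c : ℝ)) := by
    simpa only [P', Q', eval_map_algebraMap] using h
  have hdeg : P'.degree = Q'.degree := by
    rcases lt_trichotomy P'.degree Q'.degree with hlt | heq | hgt
    · exact absurd (tendsto_nhds_unique h' (div_tendsto_atTop_zero_of_degree_lt P' Q' hlt)) hc'
    · exact heq
    · exact absurd h'.abs (not_tendsto_nhds_of_tendsto_atTop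
        (abs_div_tendsto_atTop_atTop_of_degree_gt P' Q' hgt hQ') _)
  have hlc := tendsto_nhds_unique h' (div_tendsto_atTop_leadingCoeff_div_of_degree_eq P' Q' hdeg)
  have hP : P ≠ 0 := by
    rintro rfl
    simp [P'] at hlc
    exact hc hlc
  refine ⟨hP, Q.leadingCoeff, ?_⟩
  rw [eq_div_iff (leadingCoeff_ne_zero.mpr hQ'), leadingCoeff_map_of_injective hinj,
    leadingCoeff_map_of_injective hinj, algebraMap_int_eq, eq_intCast, eq_intCast] at hlc
  exact_mod_cast hlc.symm

lemma abs_le_of_tendsto_atTop {P Q : ℤ[X]} (hQ : Q ≠ 0) {c : ℤ}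
    (hc : c ≠ 0) (h : Tendsto (fun t : ℝ => aeval t P / aeval t Q) atTop (𝓝 (c : ℝ))) :
    (|c| : ℤ) ≤ intLOne P := by
  obtain ⟨hP, hdvd⟩ := dvd_leadingCoeff_of_tendsto_atTop hQ hc h
  exact (abs_le_normRingSeminorm_of_dvd (leadingCoeff_ne_zero.mpr hP) hdvd).trans
    (coeff_le_lOne _ P _)

lemma abs_le_of_tendsto_atBot {P Q : ℤ[X]} (hQ : Q ≠ 0) {c : ℤ}
    (hc : c ≠ 0) (h : Tendsto (fun t : ℝ => aeval t P / aeval t Q) atBot (𝓝 (c : ℝ))) :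
    (|c| : ℤ) ≤ intLOne P := by
  -- The substitution `t ↦ -t` reduces to `+∞` and alters the leading coefficient only by a sign.
  have hQ' : Q.comp (-X) ≠ 0 := by
    intro h0
    have := congrArg (fun p : ℤ[X] => p.comp (-X)) h0
    simp [comp_assoc] at this
    exact hQ this
  have h' := h.comp tendsto_neg_atTop_atBot
  obtain ⟨hP, hdvd⟩ := dvd_leadingCoeff_of_tendsto_atTop (P := P.comp (-X)) hQ' hc (by
    simpa only [aeval_comp, map_neg, aeval_X, Function.comp_def] using h')
  have hP' : P ≠ 0 := by rintro rfl; simp at hP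
  rw [comp_neg_X_leadingCoeff_eq, (isUnit_one.neg.pow _).dvd_mul_left] at hdvd
  exact (abs_le_normRingSeminorm_of_dvd (leadingCoeff_ne_zero.mpr hP') hdvd).trans
    (coeff_le_lOne _ P _)

/-! ### Asymptotes parallel to the direction of projection -/

namespace RatParam

/-- A linear form that vanishes on the direction of a line varies little near the line. -/
lemma abs_linear_sub_le_infDist {p v : Fin 3 → ℝ} (L : (Fin 3 → ℝ) →ₗ[ℝ] ℝ) {M : ℝ} (hM : 0 < M)
    (hL : ∀ x, |L x| ≤ M * ‖x‖) (hv : L v = 0) (x : Fin 3 → ℝ) :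
    |L x - L p| ≤ M * Metric.infDist x (line p v) := by
  have hne : (line p v).Nonempty := ⟨p, 0, by simp⟩
  rw [mul_comm, ← div_le_iff₀ hM, Metric.le_infDist hne]
  rintro _ ⟨s, rfl⟩
  rw [div_le_iff₀ hM, mul_comm, dist_eq_norm]
  refine le_trans (le_of_eq ?_) (hL _)
  simp [hv]

lemma tendsto_linear_of_isAsymptote {φ : RatParam 3} {p v : Fin 3 → ℝ} {l : Filter ℝ}
    (h : Tendsto (fun t : ℝ => Metric.infDist (φ.eval t) (line p v)) l (𝓝 0))
    (L : (Fin 3 → ℝ) →ₗ[ℝ] ℝ) {M : ℝ} (hM : 0 < M)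
    (hL : ∀ x, |L x| ≤ M * ‖x‖) (hv : L v = 0) :
    Tendsto (fun t : ℝ => L (φ.eval t)) l (𝓝 (L p)) := by
  rw [tendsto_iff_dist_tendsto_zero]
  refine squeeze_zero (fun _ => dist_nonneg) (fun t => abs_linear_sub_le_infDist L hM hL hv _) ?_
  simpa using h.const_mul M

/-- Along a branch asymptotic to a line in the direction of projection, the third coordinate is
unbounded, and `y + a z` converges. -/
lemma tendsto_of_parallel_asymptote {φ : RatParam 3} {a : ℤ} {p v : Fin 3 → ℝ} {l : Filter ℝ}
    (hv : shearProj a v = 0)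
    (hnorm : Tendsto (fun t : ℝ => ‖φ.eval t‖) l atTop)
    (hdist : Tendsto (fun t : ℝ => Metric.infDist (φ.eval t) (line p v)) l (𝓝 0)) :
    Tendsto (fun t : ℝ => |φ.eval t 2|) l atTop ∧
      ∃ c, Tendsto (fun t : ℝ => φ.eval t 1 + a * φ.eval t 2) l (𝓝 c) := by
  have hv0 : v 0 = 0 := congrFun hv 0
  have hv1 : v 1 + a * v 2 = 0 := congrFun hv 1
  have hx := tendsto_linear_of_isAsymptote hdist (LinearMap.proj 0) one_pos
    (fun x => by simpa using norm_le_pi_norm x 0) hv0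
  have hw := tendsto_linear_of_isAsymptote (M := 1 + |(a : ℝ)|) hdist
    (LinearMap.proj 1 + (a : ℝ) • LinearMap.proj 2) (by positivity)
    (fun x => by
      have h1 := norm_le_pi_norm x 1
      have h2 := norm_le_pi_norm x 2
      rw [Real.norm_eq_abs] at h1 h2
      simp only [LinearMap.add_apply, LinearMap.proj_apply, LinearMap.smul_apply, smul_eq_mul]
      refine (abs_add_le _ _).trans ?_
      rw [abs_mul, add_mul, one_mul]
      exact add_le_add h1 (mul_le_mul_of_nonneg_left h2 (abs_nonneg _))) (by simpa using hv1)
  simp only [LinearMap.add_apply, LinearMap.proj_apply, LinearMap.smul_apply, smul_eq_mul] at hx hw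
  refine ⟨?_, _, hw⟩
  -- With `x` and `y + a z` bounded, the norm is at most a constant plus `(1 + |a|) |z|`, so `|z|`
  -- must diverge.
  have hb : ∀ᶠ t in l, ‖φ.eval t‖ ≤ (|p 0| + 1 + (|p 1 + a * p 2| + 1)) +
      (1 + |(a : ℝ)|) * |φ.eval t 2| := by
    filter_upwards [hx.abs.eventually_le_const (lt_add_one _),
      hw.abs.eventually_le_const (lt_add_one _)] with t h0 h1
    have hA : 0 ≤ |p 0| := abs_nonneg _
    have hB : 0 ≤ |p 1 + a * p 2| := abs_nonneg _
    have hz : 0 ≤ |φ.eval t 2| := abs_nonneg _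
    have haz : 0 ≤ |(a : ℝ)| * |φ.eval t 2| := by positivity
    rw [pi_norm_le_iff_of_nonneg (by positivity)]
    intro i
    rw [Real.norm_eq_abs]
    fin_cases i
    · simp only [Fin.zero_eta, Fin.isValue]
      linarith
    · have : |φ.eval t 1| ≤ |φ.eval t 1 + a * φ.eval t 2| + |(a : ℝ)| * |φ.eval t 2| := by
        rw [← abs_mul]
        simpa using abs_sub (φ.eval t 1 + a * φ.eval t 2) (a * φ.eval t 2)
      simp only [Fin.mk_one, Fin.isValue]
      linarith
    · simp only [Fin.reduceFinMk, Fin.isValue]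
      linarith
  have hpos : 0 < 1 + |(a : ℝ)| := by positivity
  refine tendsto_atTop_mono' l (hb.mono fun t ht => ?_) ((tendsto_atTop_add_const_right l
    (-(|p 0| + 1 + (|p 1 + a * p 2| + 1))) hnorm).atTop_div_const hpos)
  rw [div_le_iff₀ hpos]
  linarith

/-- Write `y / z = (y + a z) / z - a`. -/
lemma tendsto_ratio_of_parallel {y z : ℝ → ℝ} {a c : ℝ} {l : Filter ℝ}
    (hz : Tendsto (fun t => |z t|) l atTop) (hw : Tendsto (fun t => y t + a * z t) l (𝓝 c)) :
    Tendsto (fun t => y t / z t) l (𝓝 (-a)) := by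
  have hinv : Tendsto (fun t => (z t)⁻¹) l (𝓝 0) :=
    tendsto_inv₀_cobounded.comp (tendsto_norm_atTop_iff_cobounded.mp hz)
  have h := (hw.mul hinv).sub_const a
  rw [mul_zero, zero_sub] at h
  refine h.congr' ?_
  filter_upwards [hz.eventually_ge_atTop 1] with t ht
  have hzt : z t ≠ 0 := by
    intro h0
    rw [h0, abs_zero] at ht
    linarith
  field_simp
  ring

/-- A coordinate converges at a parameter that is not a zero of its denominator. -/
lemma tendsto_eval_of_den_ne_zero {φ : RatParam 3} {i : Fin 3} {t₀ : ℝ} {l : Filter ℝ}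
    (hl : l ≤ 𝓝 t₀) (h : aeval t₀ (φ.den i) ≠ 0) :
    Tendsto (fun t : ℝ => φ.eval t i) l (𝓝 (φ.eval t₀ i)) := by
  have hcont : ∀ p : ℤ[X], Tendsto (fun t : ℝ => aeval t p) l (𝓝 (aeval t₀ p)) := fun p =>
    (p.continuous_aeval.tendsto t₀).mono_left hl
  exact (hcont _).div (hcont _) h

lemma abs_le_of_asymptote_at_pole {φ : RatParam 3} (hr : φ.IsReduced) {d : ℕ} {T : ℝ}
    (hT : 1 ≤ T) (h : φ.HasNormBound d T) {a : ℤ} (ha : a ≠ 0) {t₀ : ℝ} {l : Filter ℝ} [l.NeBot]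
    (hl : l ≤ 𝓝[≠] t₀) (hz : Tendsto (fun t : ℝ => |φ.eval t 2|) l atTop)
    {c : ℝ} (hw : Tendsto (fun t : ℝ => φ.eval t 1 + a * φ.eval t 2) l (𝓝 c)) :
    (|a| : ℤ) ≤ ((3 * d).factorial : ℝ) * (3 * 2 ^ d * T ^ 2) ^ (3 * d) := by
  have hl' : l ≤ 𝓝 t₀ := hl.trans nhdsWithin_le_nhds
  have haR : (a : ℝ) ≠ 0 := by exact_mod_cast ha
  have hq₃ : aeval t₀ (φ.den 2) = 0 := by
    by_contra h0
    exact not_tendsto_nhds_of_tendsto_atTop hz _ (tendsto_eval_of_den_ne_zero hl' h0).abs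
  -- Otherwise `y` converges, and with it `z = ((y + a z) - y) / a`.
  have hq₂ : aeval t₀ (φ.den 1) = 0 := by
    by_contra h0
    have hy := tendsto_eval_of_den_ne_zero hl' h0
    have h1 := (hw.sub hy).const_mul (a : ℝ)⁻¹
    refine not_tendsto_nhds_of_tendsto_atTop hz _ (h1.congr fun t => ?_).abs
    field_simp
    ring
  have hp₃ : aeval t₀ (φ.num 2) ≠ 0 := fun h0 => hr.not_both_zero 2 t₀ ⟨h0, hq₃⟩
  have hp₂ : aeval t₀ (φ.num 1) ≠ 0 := fun h0 => hr.not_both_zero 1 t₀ ⟨h0, hq₂⟩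
  have hρ := tendsto_ratio_of_parallel hz hw
  have hinj : Function.Injective (algebraMap ℤ ℝ) := (algebraMap ℤ ℝ).injective_int
  have hev : ∀ (t : ℝ) (p : ℤ[X]), (p.map (algebraMap ℤ ℝ)).eval t = aeval t p :=
    fun t p => eval_map_algebraMap p t
  have hnz : ∀ i, (φ.den i).map (algebraMap ℤ ℝ) ≠ 0 := fun i =>
    (Polynomial.map_ne_zero_iff hinj).mpr (hr i).1
  have hden : ∀ i, ∀ᶠ t in l, aeval t (φ.den i) ≠ 0 := by
    intro i
    have hfin : ∀ᶠ t in 𝓝[≠] t₀, ((φ.den i).map (algebraMap ℤ ℝ)).eval t ≠ 0 := by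
      have hs : (({t | ((φ.den i).map (algebraMap ℤ ℝ)).IsRoot t} : Set ℝ) \ {t₀}).Finite :=
        (finite_setOfPred_isRoot (hnz i)).subset Set.sdiff_subset
      have := hs.isClosed.isOpen_compl.mem_nhds (x := t₀) (by simp)
      filter_upwards [nhdsWithin_le_nhds this, self_mem_nhdsWithin] with t ht hne h0
      exact ht ⟨h0, hne⟩
    filter_upwards [hl hfin] with t ht
    rwa [hev] at ht
  obtain ⟨m, r₂, r₃, h₂, h₃, hr₂, hrel⟩ := exists_common_order_of_tendsto (neg_ne_zero.mpr haR) hl hρ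
    (p₂ := (φ.num 1).map (algebraMap ℤ ℝ)) (p₃ := (φ.num 2).map (algebraMap ℤ ℝ))
    (by
      filter_upwards [hden 1, hden 2, hz.eventually_ge_atTop 1] with t h1 h2 hzt
      have hzt0 : aeval t (φ.num 2) ≠ 0 := by
        intro h0
        rw [eval, h0, zero_div, abs_zero] at hzt
        linarith
      simp only [hev, eval]
      field_simp)
    (by rwa [hev]) (by rwa [hev]) (hnz 1) (hnz 2)
  have hH : ∀ {i : Fin 3} {r : ℝ[X]}, (φ.den i).map (algebraMap ℤ ℝ) = (X - C t₀) ^ m * r →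
      aeval t₀ (hasseDeriv m (φ.den i)) = r.eval t₀ := by
    intro i r hir
    rw [← hev, map_hasseDeriv, eval_hasseDeriv_of_eq_pow_mul hir]
  rw [hev, hev, ← hH h₂, ← hH h₃] at hrel
  rw [← hH h₂] at hr₂
  have hevC : ∀ p : ℤ[X], p.eval₂ (algebraMap ℤ ℂ) (t₀ : ℂ) = ((aeval t₀ p : ℝ) : ℂ) := fun p =>
    aeval_algebraMap_apply ℂ t₀ p
  have hb1 : ∀ i j, (φ.num i * hasseDeriv m (φ.den j)).natDegree ≤ 2 * d ∧
      intLOne (φ.num i * hasseDeriv m (φ.den j)) ≤ 2 ^ d * T ^ 2 := by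
    intro i j
    constructor
    · rw [two_mul]
      exact natDegree_mul_le_of_le (h i).1.1 ((natDegree_hasseDeriv_le _ _).trans
        ((Nat.sub_le _ _).trans (h j).2.1))
    · refine (map_mul_le_mul _ _ _).trans ?_
      have e := (intLOne_hasseDeriv_le (φ.den j) (h j).2.1 m).trans
        (mul_le_mul_of_nonneg_left (h j).2.2 (by positivity))
      exact (mul_le_mul (h i).1.2 e (apply_nonneg _ _) (by positivity)).trans
        (le_of_eq (by ring))
  have h2d : (1 : ℝ) ≤ 2 ^ d := one_le_pow₀ (by norm_num)
  have hTT : T ≤ T ^ 2 := le_self_pow₀ hT (by norm_num)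
  have hB : (1 : ℝ) ≤ 2 ^ d * T ^ 2 := one_le_mul_of_one_le_of_one_le h2d (hT.trans hTT)
  have hTB : T ≤ 2 ^ d * T ^ 2 := hTT.trans (le_mul_of_one_le_left (by positivity) h2d)
  -- Now `A = ℤ`, `f = q₃`, `g = p₂ q₃⁽ᵐ⁾` and `h = p₃ q₂⁽ᵐ⁾`, with common root `t₀` of `f` and `g +
  -- a h`. The term `h` alone is already nonzero there.
  obtain ⟨r, hr0, hdvd, hle⟩ := exists_dvd_of_pencil_root (normRingSeminorm ℤ)
    normRingSeminorm_int_one (σ := algebraMap ℤ ℂ) (algebraMap ℤ ℂ).injective_int (hr 2).1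
    (hb1 1 2).1 (hb1 2 1).1 (B := 3 * 2 ^ d * T ^ 2) (s := (t₀ : ℂ))
    ((h 2).2.2.trans (by linarith))
    (by
      have e1 := (hb1 1 2).2
      have e2 := (hb1 2 1).2
      rw [intLOne] at e1 e2
      linarith)
    (by rw [hevC, hq₃, Complex.ofReal_zero])
    (by
      rintro ⟨-, h0⟩
      rw [hevC, Complex.ofReal_eq_zero, map_mul] at h0
      exact mul_ne_zero hp₃ hr₂ h0)
    ha (by
      rw [hevC, hevC, map_mul, map_mul, hrel, algebraMap_int_eq, eq_intCast]
      push_cast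
      ring)
  have hN : (φ.den 2).natDegree + 2 * d ≤ 3 * d := by
    linarith [(h 2).2.1]
  refine (abs_le_normRingSeminorm_of_dvd hr0 hdvd).trans (hle.trans ?_)
  exact mul_le_mul (by exact_mod_cast Nat.factorial_le hN)
    (pow_le_pow_right₀ (by linarith) hN) (by positivity) (by positivity)

/-- For large `|a|` no asymptote is parallel to the direction of projection. -/
theorem not_parallel_of_large {φ : RatParam 3} (hr : φ.IsReduced) (hc : φ.NoConstantCoord)
    {d : ℕ} {T : ℝ} (hT : 1 ≤ T) (h : φ.HasNormBound d T) {a : ℤ} (ha₁ : T ^ 2 < (|a| : ℤ))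
    (ha : ((3 * d).factorial : ℝ) * (3 * 2 ^ d * T ^ 2) ^ (3 * d) < (|a| : ℤ))
    {p v : Fin 3 → ℝ} (has : φ.IsAsymptote p v) : shearProj a v ≠ 0 := by
  intro hv
  obtain ⟨-, l, hl, hnorm, hdist⟩ := has
  obtain ⟨hz, c, hw⟩ := tendsto_of_parallel_asymptote hv hnorm hdist
  have ha0 : a ≠ 0 := by
    rintro rfl
    rw [abs_zero, Int.cast_zero] at ha₁
    linarith [sq_nonneg T]
  have hρ := tendsto_ratio_of_parallel hz hw
  have hQ : φ.den 1 * φ.num 2 ≠ 0 := by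
    refine mul_ne_zero (hr 1).1 fun h0 => hc 2 ⟨0, by simp [h0]⟩
  have hρ' : Tendsto (fun t : ℝ => aeval t (φ.num 1 * φ.den 2) / aeval t (φ.den 1 * φ.num 2)) l
      (𝓝 ((-a : ℤ) : ℝ)) := by
    rw [Int.cast_neg]
    refine hρ.congr fun t => ?_
    rw [eval, eval, div_div_div_eq, map_mul, map_mul]
  have hP : intLOne (φ.num 1 * φ.den 2) ≤ T ^ 2 := by
    refine (map_mul_le_mul _ _ _).trans ?_
    rw [sq]
    exact mul_le_mul (h 1).1.2 (h 2).2.2 (apply_nonneg _ _) (by positivity)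
  have hfin : ∀ {t₀ : ℝ} {l : Filter ℝ} [l.NeBot], l ≤ 𝓝[≠] t₀ →
      Tendsto (fun t : ℝ => |φ.eval t 2|) l atTop →
      Tendsto (fun t : ℝ => φ.eval t 1 + a * φ.eval t 2) l (𝓝 c) → False :=
    fun hl hz hw => absurd (abs_le_of_asymptote_at_pole hr hT h ha0 hl hz hw) (not_le.mpr ha)
  rcases hl with rfl | rfl | ⟨t₀, rfl | rfl⟩
  · have := abs_le_of_tendsto_atTop hQ (neg_ne_zero.mpr ha0) hρ'
    rw [abs_neg] at this
    linarith
  · have := abs_le_of_tendsto_atBot hQ (neg_ne_zero.mpr ha0) hρ'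
    rw [abs_neg] at this
    linarith
  · exact hfin (l := 𝓝[<] t₀) (nhdsWithin_mono _ fun x hx => ne_of_lt hx) hz hw
  · exact hfin (l := 𝓝[>] t₀) (nhdsWithin_mono _ fun x hx => ne_of_gt hx) hz hw

end RatParam

/-! ### Runs of programs and their cost -/

namespace RAM

/-- Needed because the Las Vegas claim speaks of every halting run. -/
lemma Exec.unique {P : Prog} {s s₁ : State} {c₁ : ℕ} (h₁ : Exec P s s₁ c₁) :
    ∀ {s₂ : State} {c₂ : ℕ}, Exec P s s₂ c₂ → s₁ = s₂ ∧ c₁ = c₂ := by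
  induction h₁ with
  | skip s => intro _ _ h; cases h; exact ⟨rfl, rfl⟩
  | arith s dst op x y => intro _ _ h; cases h; exact ⟨rfl, rfl⟩
  | coin s dst => intro _ _ h; cases h; exact ⟨rfl, rfl⟩
  | seq _ _ ih₁ ih₂ =>
    intro _ _ h
    cases h with
    | seq h h' =>
      obtain ⟨rfl, rfl⟩ := ih₁ h
      obtain ⟨rfl, rfl⟩ := ih₂ h'
      exact ⟨rfl, rfl⟩
  | ite_pos hx _ ih =>
    intro _ _ h
    cases h with
    | ite_pos _ h =>
      obtain ⟨rfl, rfl⟩ := ih h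
      exact ⟨rfl, rfl⟩
    | ite_neg hx' _ => exact absurd hx hx'
  | ite_neg hx _ ih =>
    intro _ _ h
    cases h with
    | ite_pos hx' _ => exact absurd hx' hx
    | ite_neg _ h =>
      obtain ⟨rfl, rfl⟩ := ih h
      exact ⟨rfl, rfl⟩
  | loop_stop hx =>
    intro _ _ h
    cases h with
    | loop_stop _ => exact ⟨rfl, rfl⟩
    | loop_step hx' _ _ => exact absurd hx' hx
  | loop_step hx _ _ ih₁ ih₂ =>
    intro _ _ h
    cases h with
    | loop_stop hx' => exact absurd hx hx'
    | loop_step _ h h' =>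
      obtain ⟨rfl, rfl⟩ := ih₁ h
      obtain ⟨rfl, rfl⟩ := ih₂ h'
      exact ⟨rfl, rfl⟩

/-- `P` transforms the registers `m` into `m'` at cost at most `W`, whatever the coins, and
without tossing any. -/
def RunsLe (P : Prog) (m m' : ℕ → ℤ) (W : ℕ) : Prop :=
  ∃ c ≤ W, ∀ ω, Exec P ⟨m, ω⟩ ⟨m', ω⟩ c

lemma RunsLe.seq {P Q : Prog} {m m' m'' : ℕ → ℤ} {W W' : ℕ} (h : RunsLe P m m' W)
    (h' : RunsLe Q m' m'' W') : RunsLe (Prog.seq P Q) m m'' (W + W') := by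
  obtain ⟨c, hc, e⟩ := h
  obtain ⟨c', hc', e'⟩ := h'
  exact ⟨c + c', add_le_add hc hc', fun ω => (e ω).seq (e' ω)⟩

lemma RunsLe.mono {P : Prog} {m m' : ℕ → ℤ} {W W' : ℕ} (h : RunsLe P m m' W) (hW : W ≤ W') :
    RunsLe P m m' W' :=
  let ⟨c, hc, e⟩ := h
  ⟨c, hc.trans hW, e⟩

lemma len_le_of_abs_le {z : ℤ} {L : ℕ} (h : |z| ≤ 2 ^ L) : len z ≤ L + 1 := by
  have h' : z.natAbs ≤ 2 ^ L := by
    zify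
    exact h
  rw [len]
  exact Nat.succ_le_succ ((Nat.log_mono_right h').trans (Nat.log_pow one_lt_two L).le)

/-- `rᵢ := x op y`. -/
abbrev assign (i : ℕ) (op : Op) (x y : Operand) : Prog := Prog.arith (Dest.reg i) op x y

/-- The bound `8 L` is `3 L` for each operand and `L` each for the address and the result. -/
lemma runsLe_assign {m : ℕ → ℤ} {i : ℕ} {op : Op} {x y : Operand} {L : ℕ} {v : ℤ}
    (hx : x.cost m ≤ 3 * L) (hy : y.cost m ≤ 3 * L) (hi : len i ≤ L)
    (hv : op.apply (x.val m) (y.val m) = v) (hL : len v ≤ L) :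
    RunsLe (assign i op x y) m (Function.update m i v) (8 * L) := by
  subst hv
  refine ⟨x.cost m + y.cost m + len i + len (op.apply (x.val m) (y.val m)), by omega,
    fun ω => Exec.arith ⟨m, ω⟩ (Dest.reg i) op x y⟩

lemma cost_const_le {m : ℕ → ℤ} {z : ℤ} {L : ℕ} (h : len z ≤ L) :
    (Operand.const z).cost m ≤ 3 * L := by
  simp only [Operand.cost]; omega

lemma cost_reg_le {m : ℕ → ℤ} {i : ℕ} {L : ℕ} (hi : len i ≤ L) (h : len (m i) ≤ L) :
    (Operand.reg i).cost m ≤ 3 * L := by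
  simp only [Operand.cost]; omega

lemma cost_ind_le {m : ℕ → ℤ} {i : ℕ} {L : ℕ} (hi : len i ≤ L) (h : len (m i) ≤ L)
    (h' : len (m (m i).toNat) ≤ L) : (Operand.ind i).cost m ≤ 3 * L := by
  simp only [Operand.cost]; omega

/-- A loop whose condition is a counter that its body decreases. -/
lemma runsLe_loop {P : Prog} {i W : ℕ} (inv : ℕ → (ℕ → ℤ) → Prop)
    (hval : ∀ j m, inv j m → m i = j)
    (hcost : ∀ j m, inv j m → (Operand.reg i).cost m ≤ W)
    (hstep : ∀ j m, inv (j + 1) m → ∃ m', RunsLe P m m' W ∧ inv j m') :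
    ∀ j m, inv j m → ∃ m', RunsLe (Prog.loop (Operand.reg i) P) m m' ((2 * j + 1) * W) ∧ inv 0 m' := by
  intro j
  induction j with
  | zero =>
    intro m hm
    refine ⟨m, ⟨(Operand.reg i).cost m, by simpa using hcost 0 m hm,
      fun ω => Exec.loop_stop (s := ⟨m, ω⟩) ?_⟩, hm⟩
    simp [Operand.val, hval 0 m hm]
  | succ j ih =>
    intro m hm
    obtain ⟨m₁, ⟨c₁, hc₁, e₁⟩, h₁⟩ := hstep j m hm
    obtain ⟨m₂, ⟨c₂, hc₂, e₂⟩, h₂⟩ := ih m₁ h₁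
    refine ⟨m₂, ⟨(Operand.reg i).cost m + c₁ + c₂, ?_,
      fun ω => Exec.loop_step (s := ⟨m, ω⟩) ?_ (e₁ ω) (e₂ ω)⟩, h₂⟩
    · have := hcost _ m hm
      calc _ ≤ W + W + (2 * j + 1) * W := add_le_add (add_le_add this hc₁) hc₂
        _ = _ := by ring
    · simp only [Operand.val, hval _ m hm]
      positivity

/-! ### The program and its analysis -/

/-- Folds one more coefficient into `r₁`, by `r₁ := 2 r₁ + c²`; the coefficient is in the register
with number `r₂ + 3`. -/
def foldBody : Prog :=
  .seq (assign 3 .add (.reg 2) (.const 3)) <|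
  .seq (assign 3 .mul (.ind 3) (.ind 3)) <|
  .seq (assign 1 .add (.reg 1) (.reg 1)) <|
  .seq (assign 1 .add (.reg 1) (.reg 3)) <|
  assign 2 .sub (.reg 2) (.const 1)

/-- One multiplication of the computation of a power. -/
def powerBody : Prog :=
  .seq (assign 0 .mul (.reg 0) (.reg 1)) <|
  assign 2 .sub (.reg 2) (.const 1)

/-- The registers `r₁`, `r₂`, `r₃` are freed by folding their contents into `r₁`. -/
def prologue : Prog :=
  .seq (assign 1 .mul (.reg 1) (.reg 1)) <|
  .seq (assign 2 .mul (.reg 2) (.reg 2)) <|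
  .seq (assign 1 .add (.reg 1) (.reg 2)) <|
  .seq (assign 2 .mul (.reg 3) (.reg 3)) <|
  .seq (assign 1 .add (.reg 1) (.reg 2)) <|
  .seq (assign 1 .add (.reg 1) (.const 1)) <|
  .seq (assign 2 .mul (.const 6) (.reg 0)) <|
  assign 2 .add (.reg 2) (.const 3)

/-- The program: it computes a number `T` that exceeds all the `ℓ¹` norms of the input polynomials
and `2 ^ (6 d)`, and returns `T ^ (19 d)`. -/
def projectionProgram : Prog :=
  .seq prologue <|
  .seq (.loop (.reg 2) foldBody) <|
  .seq (assign 2 .mul (.const 19) (.reg 0)) <|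
  .seq (assign 0 .add (.const 1) (.const 0)) <|
  .loop (.reg 2) powerBody

lemma projectionProgram_isDeterministic : projectionProgram.IsDeterministic := by
  simp [projectionProgram, prologue, foldBody, powerBody, Prog.IsDeterministic]

lemma len_le_of_abs_le_of_lt {z : ℤ} {K L : ℕ} (h : |z| ≤ 2 ^ K) (hK : K < L) : len z ≤ L :=
  (len_le_of_abs_le h).trans hK

lemma len_small {z : ℤ} {L : ℕ} (h : |z| ≤ 32) (hL : 6 ≤ L) : len z ≤ L :=
  len_le_of_abs_le_of_lt (K := 5) (by simpa using h) hL

/-- The invariant of the first loop. -/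
def FoldInv (d τ : ℕ) (inp : ℕ → ℤ) (j : ℕ) (m : ℕ → ℤ) : Prop :=
  m 0 = d ∧ m 2 = j ∧ (∀ i, 4 ≤ i → m i = inp i) ∧ j ≤ 6 * d + 3 ∧
    2 ^ (6 * d + 3 - j) ≤ m 1 ∧
    ∑ i ∈ Finset.range (6 * d + 6), inp (i + 1) ^ 2 ≤
      m 1 + ∑ i ∈ Finset.range j, inp (i + 4) ^ 2 ∧
    m 1 + 2 ^ (2 * τ) ≤ 2 ^ (6 * d + 3 - j) * (5 * 2 ^ (2 * τ))

lemma FoldInv.bounds {d τ : ℕ} {inp : ℕ → ℤ} {j : ℕ} {m : ℕ → ℤ} (h : FoldInv d τ inp j m) :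
    1 ≤ m 1 ∧ m 1 ≤ 2 ^ (6 * d + 6 + 2 * τ) := by
  obtain ⟨-, -, -, hj, h1, -, h2⟩ := h
  refine ⟨le_trans (one_le_pow₀ (by norm_num)) h1, ?_⟩
  -- The factor `5` is rounded up to `8 = 2 ^ 3`.
  have e : (2 : ℤ) ^ (6 * d + 3 - j) ≤ 2 ^ (6 * d + 3) :=
    pow_le_pow_right₀ (by norm_num) (Nat.sub_le _ _)
  have e' : (0 : ℤ) < 2 ^ (2 * τ) := by positivity
  have e₃ := mul_le_mul_of_nonneg_right e (by linarith : 0 ≤ 5 * (2 : ℤ) ^ (2 * τ))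
  have e₄ : (0 : ℤ) ≤ 2 ^ (6 * d + 3) * 2 ^ (2 * τ) := by positivity
  calc m 1 ≤ 2 ^ (6 * d + 3) * (8 * 2 ^ (2 * τ)) := by linarith
    _ = 2 ^ (6 * d + 6 + 2 * τ) := by ring

lemma nat_abs_le_two_pow {n K : ℕ} (h : n ≤ K) : |(n : ℤ)| ≤ 2 ^ K := by
  rw [Nat.abs_cast]
  exact_mod_cast h.trans Nat.lt_two_pow_self.le

lemma sq_le_of_abs_le {z : ℤ} {τ : ℕ} (h : |z| ≤ 2 ^ τ) : z ^ 2 ≤ 2 ^ (2 * τ) := by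
  rw [mul_comm, pow_mul, ← sq_abs]
  exact pow_le_pow_left₀ (abs_nonneg z) h 2

lemma foldBody_spec {d τ : ℕ} {inp : ℕ → ℤ} (hb : ∀ i, 1 ≤ i → |inp i| ≤ 2 ^ τ) {j : ℕ}
    {m : ℕ → ℤ} (h : FoldInv d τ inp (j + 1) m) :
    ∃ m', RunsLe foldBody m m' (40 * (6 * d + 7 + 2 * τ)) ∧ FoldInv d τ inp j m' := by
  obtain ⟨hm1, hm1'⟩ := h.bounds
  obtain ⟨h0, h2, hinp, hj, hlow, hsum, hup⟩ := h
  set L := 6 * d + 7 + 2 * τ with hL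
  have hL6 : 6 ≤ L := by omega
  set c := inp (j + 4) with hc
  have hcle : |c| ≤ 2 ^ τ := hb _ (by omega)
  have hc2 : c ^ 2 ≤ 2 ^ (2 * τ) := sq_le_of_abs_le hcle
  have hc0 : 0 ≤ c ^ 2 := sq_nonneg c
  have hexp : 6 * d + 3 - j = (6 * d + 3 - (j + 1)) + 1 := by omega
  -- A round at most doubles `r₁ + 2 ^ (2 τ)`, because `c² ≤ 2 ^ (2 τ)`; `prologue` leaves this sum
  -- at most `5 · 2 ^ (2 τ)`. So `r₁` keeps `O(d + τ)` bits despite the doubling.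
  have hup' : m 1 + m 1 + c ^ 2 + 2 ^ (2 * τ) ≤ 2 ^ (6 * d + 3 - j) * (5 * 2 ^ (2 * τ)) := by
    rw [hexp, pow_succ (2 : ℤ) (6 * d + 3 - (j + 1))]; linarith
  have hinv : FoldInv d τ inp j (Function.update (Function.update (Function.update (Function.update
      (Function.update m 3 ((j + 4 : ℕ) : ℤ)) 3 (c ^ 2)) 1 (m 1 + m 1)) 1 (m 1 + m 1 + c ^ 2))
      2 (j : ℤ)) := by
    refine ⟨by simpa using h0, by simp, fun i hi => ?_, by omega, ?_, ?_, ?_⟩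
    · simp only [Function.update_apply]
      rw [if_neg (by omega), if_neg (by omega), if_neg (by omega), if_neg (by omega),
        if_neg (by omega), hinp i hi]
    · simp only [ne_eq, OfNat.one_ne_ofNat, not_false_eq_true, Function.update_of_ne,
        Function.update_self]
      rw [hexp, pow_succ (2 : ℤ) (6 * d + 3 - (j + 1))]; linarith
    · simp only [ne_eq, OfNat.one_ne_ofNat, not_false_eq_true, Function.update_of_ne,
        Function.update_self]
      rw [Finset.sum_range_succ _ j] at hsum
      linarith
    · simpa using hup'
  have hb' := hinv.bounds
  simp only [ne_eq, OfNat.one_ne_ofNat, not_false_eq_true, Function.update_of_ne,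
    Function.update_self] at hb'
  have l1 : len (m 1) ≤ L := len_le_of_abs_le_of_lt (abs_le.mpr ⟨by linarith, hm1'⟩) (by omega)
  have l1' : len (m 1 + m 1 + c ^ 2) ≤ L :=
    len_le_of_abs_le_of_lt (abs_le.mpr ⟨by linarith, hb'.2⟩) (by omega)
  have l1'' : len (m 1 + m 1) ≤ L :=
    len_le_of_abs_le_of_lt (abs_le.mpr ⟨by linarith, by linarith [hb'.2]⟩) (K := 6 * d + 6 + 2 * τ)
      (by omega)
  have lc : len c ≤ L := len_le_of_abs_le_of_lt hcle (by omega)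
  have lc2 : len (c ^ 2) ≤ L :=
    len_le_of_abs_le_of_lt (abs_le.mpr ⟨by linarith [pow_pos (zero_lt_two' ℤ) (2 * τ)], hc2⟩)
      (by omega)
  have lj : ∀ i : ℕ, i ≤ j + 4 → len (i : ℤ) ≤ L := fun i hi =>
    len_le_of_abs_le_of_lt (nat_abs_le_two_pow (K := 6 * d + 6) (by omega)) (by omega)
  have li : ∀ i : ℕ, i ≤ 3 → len (i : ℤ) ≤ L := fun i hi => lj i (by omega)
  have l2 : len (m 2) ≤ L := h2 ▸ lj (j + 1) (by omega)
  have e1 : (Function.update m 3 ((j + 4 : ℕ) : ℤ)) (j + 4) = c := by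
    rw [Function.update_of_ne (by omega), hinp _ (by omega)]
  refine ⟨_, RunsLe.mono (RunsLe.seq (runsLe_assign (v := ((j + 4 : ℕ) : ℤ)) (L := L) ?_ ?_ ?_ ?_ ?_)
    (RunsLe.seq (runsLe_assign (v := c ^ 2) (L := L) ?_ ?_ ?_ ?_ ?_)
    (RunsLe.seq (runsLe_assign (v := m 1 + m 1) (L := L) ?_ ?_ ?_ ?_ ?_)
    (RunsLe.seq (runsLe_assign (v := m 1 + m 1 + c ^ 2) (L := L) ?_ ?_ ?_ ?_ ?_)
    (runsLe_assign (v := (j : ℤ)) (L := L) ?_ ?_ ?_ ?_ ?_))))) (by omega), hinv⟩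
  · exact cost_reg_le (li 2 (by norm_num)) l2
  · exact cost_const_le (li 3 (by norm_num))
  · exact li 3 (by norm_num)
  · simp only [Op.apply, Operand.val, h2]; push_cast; ring
  · exact lj _ le_rfl
  · refine cost_ind_le (li 3 (by norm_num)) ?_ ?_
    · rw [Function.update_self]; exact lj _ le_rfl
    · rw [Function.update_self, Int.toNat_natCast, e1]; exact lc
  · refine cost_ind_le (li 3 (by norm_num)) ?_ ?_
    · rw [Function.update_self]; exact lj _ le_rfl
    · rw [Function.update_self, Int.toNat_natCast, e1]; exact lc
  · exact li 3 (by norm_num)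
  · simp only [Op.apply, Operand.val, Function.update_self, Int.toNat_natCast, e1]; ring
  · exact lc2
  · exact cost_reg_le (li 1 (by norm_num)) (by simpa using l1)
  · exact cost_reg_le (li 1 (by norm_num)) (by simpa using l1)
  · exact li 1 (by norm_num)
  · simp [Op.apply, Operand.val]
  · exact l1''
  · exact cost_reg_le (li 1 (by norm_num)) (by simpa using l1'')
  · exact cost_reg_le (li 3 (by norm_num)) (by simpa using lc2)
  · exact li 1 (by norm_num)
  · simp [Op.apply, Operand.val]
  · exact l1'
  · exact cost_reg_le (li 2 (by norm_num)) (by simpa using l2)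
  · exact cost_const_le (li 1 (by norm_num))
  · exact li 2 (by norm_num)
  · simp [Op.apply, Operand.val, h2]
  · exact lj j (by omega)

lemma prologue_spec {d τ : ℕ} {inp : ℕ → ℤ} (h0 : inp 0 = d) (hb : ∀ i, 1 ≤ i → |inp i| ≤ 2 ^ τ) :
    ∃ m', RunsLe prologue inp m' (64 * (6 * d + 7 + 2 * τ)) ∧ FoldInv d τ inp (6 * d + 3) m' := by
  set L := 6 * d + 7 + 2 * τ with hL
  have hL6 : 6 ≤ L := by omega
  have hsq : ∀ i, 1 ≤ i → inp i ^ 2 ≤ 2 ^ (2 * τ) := fun i hi => sq_le_of_abs_le (hb i hi)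
  have b1 := hsq 1 le_rfl
  have b2 := hsq 2 (by norm_num)
  have b3 := hsq 3 (by norm_num)
  have n1 := sq_nonneg (inp 1)
  have n2 := sq_nonneg (inp 2)
  have n3 := sq_nonneg (inp 3)
  have hM : (1 : ℤ) ≤ 2 ^ (2 * τ) := one_le_pow₀ (by norm_num)
  have hbd : ∀ z : ℤ, 0 ≤ z → z ≤ 4 * 2 ^ (2 * τ) → len z ≤ L := by
    intro z hz hz'
    refine len_le_of_abs_le_of_lt (K := 2 * τ + 2) ?_ (by omega)
    rw [abs_of_nonneg hz, pow_add]
    linarith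
  -- There are `6 (d + 1)` coefficients; three are folded in here, so registers `4` to `6 d + 6`
  -- remain. The added `1` makes `r₁` positive, so that the `6 d + 3` doublings bring it to at least
  -- `2 ^ (6 d + 3)`.
  have hinv : FoldInv d τ inp (6 * d + 3) (Function.update (Function.update (Function.update
      (Function.update (Function.update (Function.update (Function.update (Function.update inp
        1 (inp 1 ^ 2)) 2 (inp 2 ^ 2)) 1 (inp 1 ^ 2 + inp 2 ^ 2)) 2 (inp 3 ^ 2))
        1 (inp 1 ^ 2 + inp 2 ^ 2 + inp 3 ^ 2)) 1 (inp 1 ^ 2 + inp 2 ^ 2 + inp 3 ^ 2 + 1))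
        2 (6 * d)) 2 (6 * d + 3)) := by
    refine ⟨by simpa using h0, by simp, fun i hi => ?_, le_rfl, ?_, ?_, ?_⟩
    · simp only [Function.update_apply]
      simp only [show i ≠ 1 by omega, show i ≠ 2 by omega, if_false]
    · simp only [ne_eq, OfNat.one_ne_ofNat, not_false_eq_true, Function.update_of_ne,
        Function.update_self, Nat.sub_self, pow_zero]
      linarith
    · simp only [ne_eq, OfNat.one_ne_ofNat, not_false_eq_true, Function.update_of_ne,
        Function.update_self]
      rw [Finset.sum_range_succ', Finset.sum_range_succ', Finset.sum_range_succ']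
      linarith
    · simp only [ne_eq, OfNat.one_ne_ofNat, not_false_eq_true, Function.update_of_ne,
        Function.update_self, Nat.sub_self, pow_zero]
      linarith
  have li : ∀ z : ℤ, |z| ≤ 32 → len z ≤ L := fun z hz => len_small hz hL6
  have i1 : len ((1 : ℕ) : ℤ) ≤ L := li _ (by norm_num)
  have i2 : len ((2 : ℕ) : ℤ) ≤ L := li _ (by norm_num)
  have lc : ∀ i, 1 ≤ i → len (inp i) ≤ L := fun i hi =>
    len_le_of_abs_le_of_lt (hb i hi) (by omega)
  have ld : len (d : ℤ) ≤ L :=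
    len_le_of_abs_le_of_lt (nat_abs_le_two_pow (K := 6 * d) (by omega)) (by omega)
  have l6d : len (6 * d : ℤ) ≤ L := by
    have := nat_abs_le_two_pow (n := 6 * d) le_rfl
    push_cast at this
    exact len_le_of_abs_le_of_lt this (by omega)
  have l6d3 : len (6 * d + 3 : ℤ) ≤ L := by
    have := nat_abs_le_two_pow (n := 6 * d + 3) le_rfl
    push_cast at this
    exact len_le_of_abs_le_of_lt this (by omega)
  refine ⟨_, RunsLe.mono (RunsLe.seq (runsLe_assign (v := inp 1 ^ 2) (L := L) ?_ ?_ i1 ?_ ?_)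
    (RunsLe.seq (runsLe_assign (v := inp 2 ^ 2) (L := L) ?_ ?_ i2 ?_ ?_)
    (RunsLe.seq (runsLe_assign (v := inp 1 ^ 2 + inp 2 ^ 2) (L := L) ?_ ?_ i1 ?_ ?_)
    (RunsLe.seq (runsLe_assign (v := inp 3 ^ 2) (L := L) ?_ ?_ i2 ?_ ?_)
    (RunsLe.seq (runsLe_assign (v := inp 1 ^ 2 + inp 2 ^ 2 + inp 3 ^ 2) (L := L) ?_ ?_ i1 ?_ ?_)
    (RunsLe.seq (runsLe_assign (v := inp 1 ^ 2 + inp 2 ^ 2 + inp 3 ^ 2 + 1) (L := L)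
      ?_ ?_ i1 ?_ ?_)
    (RunsLe.seq (runsLe_assign (v := (6 * d : ℤ)) (L := L) ?_ ?_ i2 ?_ ?_)
    (runsLe_assign (v := (6 * d + 3 : ℤ)) (L := L) ?_ ?_ i2 ?_ ?_)))))))) (by omega), hinv⟩
  · exact cost_reg_le i1 (lc 1 le_rfl)
  · exact cost_reg_le i1 (lc 1 le_rfl)
  · simp only [Op.apply, Operand.val]; ring
  · exact hbd _ n1 (by linarith)
  · exact cost_reg_le i2 (by simpa using lc 2 (by norm_num))
  · exact cost_reg_le i2 (by simpa using lc 2 (by norm_num))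
  · simp [Op.apply, Operand.val, sq]
  · exact hbd _ n2 (by linarith)
  · exact cost_reg_le i1 (by simpa using hbd _ n1 (by linarith))
  · exact cost_reg_le i2 (by simpa using hbd _ n2 (by linarith))
  · simp [Op.apply, Operand.val]
  · exact hbd _ (by linarith) (by linarith)
  · exact cost_reg_le (li _ (by norm_num)) (by simpa using lc 3 (by norm_num))
  · exact cost_reg_le (li _ (by norm_num)) (by simpa using lc 3 (by norm_num))
  · simp [Op.apply, Operand.val, sq]
  · exact hbd _ n3 (by linarith)
  · exact cost_reg_le i1 (by simpa using hbd (inp 1 ^ 2 + inp 2 ^ 2) (by linarith) (by linarith))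
  · exact cost_reg_le i2 (by simpa using hbd _ n3 (by linarith))
  · simp [Op.apply, Operand.val]
  · exact hbd _ (by linarith) (by linarith)
  · exact cost_reg_le i1 (by
      simpa using hbd (inp 1 ^ 2 + inp 2 ^ 2 + inp 3 ^ 2) (by linarith) (by linarith))
  · exact cost_const_le (li 1 (by norm_num))
  · simp [Op.apply, Operand.val]
  · exact hbd _ (by linarith) (by linarith)
  · exact cost_const_le (li 6 (by norm_num))
  · exact cost_reg_le (li _ (by norm_num)) (by simpa [h0] using ld)
  · simp [Op.apply, Operand.val, h0]
  · exact l6d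
  · exact cost_reg_le i2 (by simpa using l6d)
  · exact cost_const_le (li 3 (by norm_num))
  · simp [Op.apply, Operand.val]
  · exact l6d3

/-- The invariant of the second loop. -/
def PowerInv (T : ℤ) (N j : ℕ) (m : ℕ → ℤ) : Prop :=
  m 0 = T ^ (N - j) ∧ m 1 = T ∧ m 2 = j ∧ j ≤ N

lemma powerBody_spec {T : ℤ} {K N L : ℕ} (hT : 0 ≤ T) (hTK : T ≤ 2 ^ K) (hK : 6 ≤ K)
    (hL : (K + 1) * (N + 1) ≤ L) {j : ℕ} {m : ℕ → ℤ} (h : PowerInv T N (j + 1) m) :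
    ∃ m', RunsLe powerBody m m' (16 * L) ∧ PowerInv T N j m' := by
  obtain ⟨h0, h1, h2, hj⟩ := h
  have hKL : K < L := by nlinarith
  have hNL : N < L := by nlinarith
  have hKNL : K * N < L := by nlinarith
  have li : ∀ i : ℕ, i ≤ 2 → len (i : ℤ) ≤ L := fun i hi =>
    len_small (by rw [Nat.abs_cast]; exact_mod_cast hi.trans (by norm_num)) (by omega)
  have hpow : ∀ k ≤ N, len (T ^ k) ≤ L := by
    intro k hk
    refine len_le_of_abs_le_of_lt (K := K * N) ?_ hKNL
    rw [abs_of_nonneg (pow_nonneg hT k)]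
    calc T ^ k ≤ (2 ^ K) ^ k := pow_le_pow_left₀ hT hTK k
      _ = 2 ^ (K * k) := (pow_mul _ _ _).symm
      _ ≤ 2 ^ (K * N) := pow_le_pow_right₀ (by norm_num) (Nat.mul_le_mul_left K hk)
  have lT : len T ≤ L := len_le_of_abs_le_of_lt (by rwa [abs_of_nonneg hT]) hKL
  have lj : ∀ i : ℕ, i ≤ N → len (i : ℤ) ≤ L := fun i hi =>
    len_le_of_abs_le_of_lt (nat_abs_le_two_pow hi) hNL
  have l2 : len (m 2) ≤ L := h2 ▸ lj (j + 1) hj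
  have hinv : PowerInv T N j (Function.update (Function.update m 0 (T ^ (N - j))) 2 (j : ℤ)) :=
    ⟨by simp, by simpa using h1, by simp, by omega⟩
  refine ⟨_, RunsLe.mono (RunsLe.seq (runsLe_assign (v := T ^ (N - j)) (L := L) ?_ ?_ ?_ ?_ ?_)
    (runsLe_assign (v := (j : ℤ)) (L := L) ?_ ?_ ?_ ?_ ?_)) (by omega), hinv⟩
  · exact cost_reg_le (li 0 (by norm_num)) (by rw [h0]; exact hpow _ (by omega))
  · exact cost_reg_le (li 1 (by norm_num)) (by rwa [h1])
  · exact li 0 (by norm_num)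
  · simp only [Op.apply, Operand.val, h0, h1]
    rw [← pow_succ]
    congr 1
    omega
  · exact hpow _ (by omega)
  · exact cost_reg_le (li 2 (by norm_num)) (by simpa using l2)
  · exact cost_const_le (li 1 (by norm_num))
  · exact li 2 (by norm_num)
  · simp [Op.apply, Operand.val, h2]
  · exact lj j (by omega)

/-- The program computes `T ^ (19 d)` within the stated cost. -/
theorem projectionProgram_spec {d τ : ℕ} (hd : 1 ≤ d) {inp : ℕ → ℤ} (h0 : inp 0 = d)
    (hb : ∀ i, 1 ≤ i → |inp i| ≤ 2 ^ τ) :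
    ∃ (m' : ℕ → ℤ) (T : ℤ), RunsLe projectionProgram inp m' (180000 * (d ^ 3 + d ^ 2 * τ)) ∧
      m' 0 = T ^ (19 * d) ∧ 2 ^ (6 * d + 3) ≤ T ∧
      ∑ i ∈ Finset.range (6 * d + 6), inp (i + 1) ^ 2 ≤ T := by
  set L := 6 * d + 7 + 2 * τ with hL
  have hL6 : 6 ≤ L := by omega
  obtain ⟨m₁, r₁, inv₁⟩ := prologue_spec h0 hb
  obtain ⟨m₂, r₂, inv₂⟩ := runsLe_loop (P := foldBody) (i := 2) (W := 40 * L) (FoldInv d τ inp)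
    (fun _ _ h => h.2.1) (fun j m h => by
      have hj : j ≤ 6 * d + 3 := h.2.2.2.1
      refine (cost_reg_le (L := L) (len_small (by norm_num) hL6) ?_).trans (by omega)
      rw [h.2.1]
      exact len_le_of_abs_le_of_lt (nat_abs_le_two_pow (K := 6 * d + 3) (by omega)) (by omega))
    (fun j m h => foldBody_spec hb h) _ m₁ inv₁
  obtain ⟨hT1, hTK⟩ := inv₂.bounds
  obtain ⟨hm0, hm2, -, -, hlow, hsum, -⟩ := inv₂
  set T := m₂ 1 with hT
  have ld : len (d : ℤ) ≤ L :=
    len_le_of_abs_le_of_lt (nat_abs_le_two_pow (K := 6 * d) (by omega)) (by omega)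
  have l19 : len (19 * d : ℤ) ≤ L := by
    refine len_le_of_abs_le_of_lt (K := d + 5) ?_ (by omega)
    have := nat_abs_le_two_pow (n := d) le_rfl
    rw [abs_mul, pow_add, mul_comm]
    exact mul_le_mul this (by norm_num) (by norm_num) (by positivity)
  have r₃ : RunsLe (assign 2 .mul (.const 19) (.reg 0)) m₂
      (Function.update m₂ 2 (19 * d)) (8 * L) :=
    runsLe_assign (cost_const_le (len_small (by norm_num) hL6))
      (cost_reg_le (len_small (by norm_num) hL6) (by rwa [hm0])) (len_small (by norm_num) hL6)
      (by simp [Op.apply, Operand.val, hm0]) l19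
  have r₄ : RunsLe (assign 0 .add (.const 1) (.const 0)) (Function.update m₂ 2 (19 * d))
      (Function.update (Function.update m₂ 2 (19 * d)) 0 1) (8 * L) :=
    runsLe_assign (cost_const_le (len_small (by norm_num) hL6))
      (cost_const_le (len_small (by norm_num) hL6)) (len_small (by norm_num) hL6)
      (by simp [Op.apply, Operand.val]) (len_small (by norm_num) hL6)
  have inv₄ : PowerInv T (19 * d) (19 * d)
      (Function.update (Function.update m₂ 2 (19 * d)) 0 1) :=
    ⟨by simp, by simp [hT], by simp, le_rfl⟩
  have hL2 : L ≤ L * (19 * d + 1) := Nat.le_mul_of_pos_right _ (by omega)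
  have hL3 : 19 * d < L * (19 * d + 1) := by nlinarith
  -- As `T ≤ 2 ^ (L - 1)`, every partial power has length at most `L (19 d + 1)`.
  obtain ⟨m₅, r₅, inv₅⟩ := runsLe_loop (P := powerBody) (i := 2) (W := 16 * (L * (19 * d + 1)))
    (PowerInv T (19 * d)) (fun _ _ h => h.2.2.1) (fun j m h => by
      refine (cost_reg_le (L := L * (19 * d + 1)) (len_small (by norm_num) (hL6.trans hL2))
        ?_).trans (by omega)
      rw [h.2.2.1]
      exact len_le_of_abs_le_of_lt (nat_abs_le_two_pow (K := 19 * d) h.2.2.2) hL3)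
    (fun j m h => powerBody_spec (K := 6 * d + 6 + 2 * τ) (by linarith) hTK (by omega)
      (le_of_eq (by rw [hL]; ring)) h) _ _ inv₄
  refine ⟨m₅, T, RunsLe.mono (r₁.seq (r₂.seq (r₃.seq (r₄.seq r₅)))) ?_, inv₅.1, ?_, ?_⟩
  · have hLd : L ≤ 13 * (d + τ) := by omega
    have hdd : d ≤ d ^ 2 := Nat.le_self_pow (by norm_num) d
    have h1d : 1 ≤ d ^ 2 := hd.trans hdd
    calc _ = L * (376 + 1392 * d + 11552 * d ^ 2) := by rw [← hL]; ring
      _ ≤ (13 * (d + τ)) * (376 * d ^ 2 + 1392 * d ^ 2 + 11552 * d ^ 2) := by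
          gcongr
          exact Nat.le_mul_of_pos_right _ h1d
      _ = 173160 * (d ^ 3 + d ^ 2 * τ) := by ring
      _ ≤ _ := Nat.mul_le_mul_right _ (by norm_num)
  · simpa using hlow
  · simpa using hsum

/-! ### Norm bounds from the input registers -/

lemma encode_mul_add {d : ℕ} (L : List ℤ[X]) (k : ℕ) {j : ℕ} (hj : j ≤ d) :
    encode d L (k * (d + 1) + j + 1) = (L.getD k 0).coeff j := by
  rw [encode, mul_comm, Nat.mul_add_div (Nat.succ_pos d), Nat.mul_add_mod,
    Nat.div_eq_of_lt (Nat.lt_succ_of_le hj), Nat.mod_eq_of_lt (Nat.lt_succ_of_le hj), add_zero]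

lemma intLOne_le_of_sum_le {d : ℕ} {L : List ℤ[X]} {k : ℕ} (hk : k < 6)
    (hdeg : (L.getD k 0).natDegree ≤ d) {T : ℤ}
    (hT : ∑ i ∈ Finset.range (6 * d + 6), encode d L (i + 1) ^ 2 ≤ T) :
    intLOne (L.getD k 0) ≤ T := by
  set p := L.getD k 0 with hp
  have h1 : intLOne p = ((∑ j ∈ Finset.range (d + 1), |p.coeff j| : ℤ) : ℝ) := by
    rw [show intLOne p = _ from coeffSum_eq_sum (normRingSeminorm ℤ) p
      (s := Finset.range (d + 1)) (supp_subset_range (Nat.lt_succ_of_le hdeg)), Int.cast_sum]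
    refine Finset.sum_congr rfl fun j _ => ?_
    rw [Int.cast_abs]
    exact Int.norm_eq_abs _
  rw [h1, Int.cast_le]
  refine le_trans ?_ hT
  calc ∑ j ∈ Finset.range (d + 1), |p.coeff j|
      ≤ ∑ j ∈ Finset.range (d + 1), encode d L (k * (d + 1) + j + 1) ^ 2 := by
        refine Finset.sum_le_sum fun j hj => ?_
        rw [encode_mul_add L k (Nat.lt_succ_iff.mp (Finset.mem_range.mp hj)), ← hp, ← sq_abs]
        -- Squares of integers dominate absolute values, so the program needs no sign tests.
        exact Int.le_self_sq _
    _ = ∑ i ∈ (Finset.range (d + 1)).map (addLeftEmbedding (k * (d + 1))),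
          encode d L (i + 1) ^ 2 := by simp
    _ ≤ _ := by
        refine Finset.sum_le_sum_of_subset_of_nonneg (fun i hi => ?_) fun _ _ _ => sq_nonneg _
        obtain ⟨j, hj, rfl⟩ := Finset.mem_map.mp hi
        rw [Finset.mem_range] at hj ⊢
        simp only [addLeftEmbedding_apply]
        nlinarith

lemma abs_input_le {d τ : ℕ} {φ : RatParam 3} (h : φ.HasSize d τ) (i : ℕ) (hi : 1 ≤ i) :
    |input d φ i| ≤ 2 ^ τ := by
  obtain ⟨k, rfl⟩ := Nat.exists_eq_add_of_le' hi
  rw [input, encode]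
  set q := k / (d + 1)
  have h0 : |(0 : ℤ)| ≤ 2 ^ τ := by simp
  rcases Nat.lt_or_ge q 6 with hq | hq
  · interval_cases q
    exacts [(h 0).1.2 _, (h 0).2.2 _, (h 1).1.2 _, (h 1).2.2 _, (h 2).1.2 _, (h 2).2.2 _]
  · rw [List.getD_eq_default _ _ (by simpa using hq), coeff_zero]
    exact h0

lemma hasNormBound_of_sum_le {d τ : ℕ} {φ : RatParam 3} (h : φ.HasSize d τ) {T : ℤ}
    (hT : ∑ i ∈ Finset.range (6 * d + 6), input d φ (i + 1) ^ 2 ≤ T) : φ.HasNormBound d T := by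
  intro i
  have key := fun k hk hdeg => intLOne_le_of_sum_le (k := k) hk hdeg hT
  refine ⟨⟨(h i).1.1, ?_⟩, ⟨(h i).2.1, ?_⟩⟩
  · fin_cases i
    exacts [key 0 (by norm_num) (h 0).1.1, key 2 (by norm_num) (h 1).1.1,
      key 4 (by norm_num) (h 2).1.1]
  · fin_cases i
    exacts [key 1 (by norm_num) (h 0).2.1, key 3 (by norm_num) (h 1).2.1,
      key 5 (by norm_num) (h 2).2.1]

end RAM

/-! ### The choice of exponent and the conclusion -/

namespace RatParam

lemma NoConstantCoord.one_le_degree {n : ℕ} {φ : RatParam n} (hc : φ.NoConstantCoord)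
    (hr : φ.IsReduced) {d τ : ℕ} (h : φ.HasSize d τ) (i : Fin n) : 1 ≤ d := by
  by_contra hd
  have hd0 : d = 0 := by omega
  subst hd0
  have hnum := eq_C_of_natDegree_le_zero (h i).1.1
  have hden := eq_C_of_natDegree_le_zero (h i).2.1
  have hβ : ((φ.den i).coeff 0 : ℚ) ≠ 0 := by
    intro h0
    rw [Int.cast_eq_zero.mp h0, C_0] at hden
    exact (hr i).1 hden
  refine hc i ⟨(φ.num i).coeff 0 / (φ.den i).coeff 0, ?_⟩
  generalize (φ.num i).coeff 0 = α at hnum ⊢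
  generalize (φ.den i).coeff 0 = β at hden hβ ⊢
  rw [hnum, hden, map_C, map_C, ← C_mul, eq_intCast, eq_intCast, div_mul_cancel₀ _ hβ]

/-- A power of a sufficiently large `T` defines an admissible projection. -/
theorem isGoodProjection_pow {φ : RatParam 3} (hφ : φ.IsAdmissible) {d : ℕ} (hd : 1 ≤ d) {T : ℤ}
    (h : φ.HasNormBound d T) (hT : 2 ^ (6 * d + 3) ≤ T) : φ.IsGoodProjection (T ^ (19 * d)) := by
  obtain ⟨hr, hc, hp, -⟩ := hφ
  have h2T : (2 : ℝ) ^ (6 * d + 3) ≤ T := by exact_mod_cast hT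
  have hle : ∀ k ≤ 6 * d + 3, (2 : ℝ) ^ k ≤ T := fun k hk =>
    (pow_le_pow_right₀ (by norm_num) hk).trans h2T
  have h8 : (8 : ℝ) ≤ T := le_trans (by norm_num) (hle 3 (by omega))
  have hT1 : (1 : ℝ) < T := by linarith
  have h3d : ((3 * d : ℕ) : ℝ) ≤ T :=
    le_trans (by exact_mod_cast Nat.lt_two_pow_self.le) (hle (3 * d) (by omega))
  have h2d : (2 : ℝ) ^ d ≤ T := hle d (by omega)
  have habs : ((|T ^ (19 * d)| : ℤ) : ℝ) = (T : ℝ) ^ (19 * d) := by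
    rw [Int.cast_abs, Int.cast_pow, abs_of_pos (pow_pos (by linarith) _)]
  have hfac : ((3 * d).factorial : ℝ) ≤ (T : ℝ) ^ (3 * d) :=
    le_trans (by exact_mod_cast Nat.factorial_le_pow _) (pow_le_pow_left₀ (by positivity) h3d _)
  -- The exponent: `(3 d)! ≤ T ^ (3 d)` and `B ^ (3 d) ≤ T ^ (15 d)` give `18 d`, and one further
  -- `d` makes the inequality strict.
  have hbound : ∀ B : ℝ, 0 ≤ B → B ≤ (T : ℝ) ^ 5 →
      ((3 * d).factorial : ℝ) * B ^ (3 * d) < (|T ^ (19 * d)| : ℤ) := by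
    intro B hB0 hB
    rw [habs]
    calc ((3 * d).factorial : ℝ) * B ^ (3 * d)
        ≤ (T : ℝ) ^ (3 * d) * ((T : ℝ) ^ 5) ^ (3 * d) :=
          mul_le_mul hfac (pow_le_pow_left₀ hB0 hB _) (by positivity) (by positivity)
      _ = (T : ℝ) ^ (18 * d) := by rw [← pow_mul, ← pow_add]; congr 1; omega
      _ < (T : ℝ) ^ (19 * d) := pow_lt_pow_right₀ hT1 (by omega)
  have hT0 : (0 : ℝ) ≤ T := by linarith
  refine ⟨fun p v => not_parallel_of_large hr hc hT1.le h ?_ (hbound _ (by positivity) ?_),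
    isBirational_of_large hr hc hp hT1.le h (hbound _ (by positivity) ?_)⟩
  · rw [habs]
    exact pow_lt_pow_right₀ hT1 (by omega)
  · calc (3 : ℝ) * 2 ^ d * T ^ 2 ≤ T * T * T ^ 2 := by gcongr; linarith
      _ = (T : ℝ) ^ 4 := by ring
      _ ≤ (T : ℝ) ^ 5 := pow_le_pow_right₀ hT1.le (by norm_num)
  · calc (5 : ℝ) * T ^ 4 ≤ T * T ^ 4 := by gcongr; linarith
      _ = (T : ℝ) ^ 5 := by ring

end RatParam

instance : IsProbabilityMeasure RAM.coinLaw :=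
  inferInstanceAs (IsProbabilityMeasure (Measure.infinitePi fun _ => _))

/-- The deterministic program returns an admissible projection, at cost `O(d³ + d² τ)`. -/
theorem projectionProgram_correct {d τ : ℕ} {φ : RatParam 3} (h : φ.HasSize d τ)
    (hφ : φ.IsAdmissible) (ω : ℕ → Bool) : ∃ (s : RAM.State) (c : ℕ),
      RAM.Exec RAM.projectionProgram ⟨RAM.input d φ, ω⟩ s c ∧ φ.IsGoodProjection (s.mem 0) ∧
      c ≤ 180000 * (d ^ 3 + d ^ 2 * τ) := by
  have hd := hφ.2.1.one_le_degree hφ.1 h 0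
  obtain ⟨m', T, ⟨c, hc, he⟩, h0, hT, hsum⟩ :=
    RAM.projectionProgram_spec hd (inp := RAM.input d φ) rfl (RAM.abs_input_le h)
  refine ⟨⟨m', ω⟩, c, he ω, ?_, hc⟩
  change φ.IsGoodProjection (m' 0)
  rw [h0]
  exact RatParam.isGoodProjection_pow hφ hd (RAM.hasNormBound_of_sum_le h hsum) hT

theorem mainTheorem10 :
    -- a deterministic algorithm, with its worst-case bit complexity
    (∃ P : RAM.Prog, P.IsDeterministic ∧ ∃ C k : ℕ,
      ∀ (d τ : ℕ) (φ : RatParam 3), φ.HasSize d τ → φ.IsAdmissible →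
        ∀ ω : ℕ → Bool, ∃ (s : RAM.State) (c : ℕ),
          RAM.Exec P ⟨RAM.input d φ, ω⟩ s c ∧
          φ.IsGoodProjection (s.mem 0) ∧
          c ≤ softBound C k (d ^ 5 + d ^ 4 * τ)) ∧
    -- a Las Vegas algorithm (never a wrong output), with its expected bit complexity
    (∃ P : RAM.Prog, ∃ C k : ℕ,
      ∀ (d τ : ℕ) (φ : RatParam 3), φ.HasSize d τ → φ.IsAdmissible →
        (∀ (ω : ℕ → Bool) (s : RAM.State) (c : ℕ),
          RAM.Exec P ⟨RAM.input d φ, ω⟩ s c → φ.IsGoodProjection (s.mem 0)) ∧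
        RAM.expectedCost P (RAM.input d φ) ≤
          (softBound C k (d ^ 3 + d ^ 2 * τ) : ENNReal)) := by
  refine ⟨⟨RAM.projectionProgram, RAM.projectionProgram_isDeterministic, 180000, 0,
    fun d τ φ h hφ ω => ?_⟩, ⟨RAM.projectionProgram, 180000, 0, fun d τ φ h hφ => ⟨?_, ?_⟩⟩⟩
  · obtain ⟨s, c, he, hgood, hc⟩ := projectionProgram_correct h hφ ω
    refine ⟨s, c, he, hgood, hc.trans ?_⟩
    -- Nonconstant coordinates force `d ≥ 1`, so `d³ + d² τ ≤ d⁵ + d⁴ τ`, with no logarithmic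
    -- factor.
    have hd := hφ.2.1.one_le_degree hφ.1 h 0
    rw [softBound, pow_zero, mul_one]
    gcongr <;> first | exact hd | norm_num
  · intro ω s c he
    obtain ⟨s', c', he', hgood, -⟩ := projectionProgram_correct h hφ ω
    exact (he.unique he').1 ▸ hgood
  · have hω : ∀ ω, RAM.runCost RAM.projectionProgram ⟨RAM.input d φ, ω⟩ ≤
        (softBound 180000 0 (d ^ 3 + d ^ 2 * τ) : ENNReal) := by
      intro ω
      obtain ⟨s, c, he, -, hc⟩ := projectionProgram_correct h hφ ω
      refine (iInf_le_of_le s (iInf_le_of_le c (iInf_le_of_le he le_rfl))).trans ?_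
      rw [softBound, pow_zero, mul_one]
      exact_mod_cast hc
    refine (lintegral_mono hω).trans ?_
    rw [lintegral_const, measure_univ, mul_one]

end
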